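/- Let $K$ be a field of characteristic zero, $n\ge 0$, $P_n=K[x_1,\dots,x_n]$, and let $\mathbb I_n\subseteq \mathrm{End}_K(P_n)$ be the $K$-subalgebra generated by the multiplications by $x_i$, the partial derivatives $\partial_i=\partial/\partial x_i$ and the integrations $\int_i: x^\alpha\mapsto(\alpha_i+1)^{-1}x_ix^\alpha$ ($1\le i\le n$). Put $\mathbb I_1(i)=K\langle x_i,\partial_i,\int_i\rangle$ and let $F(i)$ be the $K$-span of the elements $e_{st}(i)=\int_i^s\partial_i^t-\int_i^{s+1}\partial_i^{t+1}$ ($s,t\ge0$). For $f:\{1,\dots,n\}\to\{0,1\}$ let $I_f=I_{f(1)}\otimes\cdots\otimes I_{f(n)}\subseteq\mathbb I_n$ be the $K$-span of all products $a_1\cdots a_n$ with $a_i\in F(i)$ if $f(i)=0$ and $a_i\in\mathbb I_1(i)$ if $f(i)=1$. Let $\mathfrak p_i=I_f$ with $f(i)=0$ and $f(j)=1$ for $j\ne i$ (that is, $\mathfrak p_i=\mathbb I_{i-1}\otimes F\otimes\mathbb I_{n-i}$), and let $F_n=F^{\otimes n}=I_{(0,\dots,0)}$. "Ideal" means two-sided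 ideal; a proper ideal $\mathfrak p$ is prime if $\mathfrak a\mathfrak b\subseteq\mathfrak p$ implies $\mathfrak a\subseteq\mathfrak p$ or $\mathfrak b\subseteq\mathfrak p$ for all ideals $\mathfrak a,\mathfrak b$; heights and the classical Krull dimension are defined by chains of prime ideals. Then every $I_f$ is an ideal of $\mathbb I_n$, and: 1. $\mathbb I_n$ is a prime algebra (its zero ideal is prime). 2. The set of height one primes of $\mathbb I_n$ is $\{\mathfrak p_1,\dots,\mathfrak p_n\}$. 3. $\mathfrak a^2=\mathfrak a$ for every ideal $\mathfrak a$. 4. $\mathfrak a\mathfrak b=\mathfrak b\mathfrak a$ for all ideals $\mathfrak a,\mathfrak b$. 5. The lattice of ideals of $\mathbb I_n$ is distributive. 6. The classical Krull dimension of $\mathbb I_n$ is $n$. 7. $\mathfrak a\mathfrak b=\mathfrak a\cap\mathfrak b$ for all ideals $\mathfrak a,\mathfrak b$. 8. $\mathfrak a_n:=\mathfrak p_1+\cdots+\mathfrak p_n$ is the largest ideal distinct from $\mathbb I_n$, hence the only maximal ideal, and $F_n=\bigcap_{i=1}^n\mathfrak p_i$ is the smallest nonzero ideal. 9. The map $C\mapsto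 I_C:=\sum_{f\in C}I_f$ (with $I_\emptyset=0$) is a bijection from the set of antichains of $\{0,1\}^n$ (with the componentwise order) to the set of ideals of $\mathbb I_n$. Hence the number of ideals is the Dedekind number $\mathfrak d_n$, the number of these antichains; moreover $2-n+\sum_{i=1}^n2^{\binom ni}\le\mathfrak d_n\le2^{2^n}$. For $n=1$, $F$ is the only ideal other than $0$ and $\mathbb I_1$. 10. The map $I\mapsto\mathfrak p_I:=\sum_{i\in I}\mathfrak p_i$ (with $\mathfrak p_\emptyset=0$) is a bijection from the set of subsets of $\{1,\dots,n\}$ to $\mathrm{Spec}(\mathbb I_n)$, the set of prime ideals; every nonzero prime ideal is the sum of a unique set of height one primes; $|\mathrm{Spec}(\mathbb I_n)|=2^n$; and the height of $\mathfrak p_I$ is $|I|$. 11. $\mathfrak p_I\subseteq\mathfrak p_J$ if and only if $I\subseteq J$, and likewise for strict inclusions. 12. $\mathbb I_n$ is catenary: its classical Krull dimension is finite and, for all primes $\mathfrak p\subseteq\mathfrak q$, all maximal chains of primes from $\mathfrak p$ to $\mathfrak q$ have the same length. -/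

import Mathlib

noncomputable section

/-! ## Two-sided ideals of a (not necessarily commutative) ring -/

namespace RingIdeal

variable {R : Type*} [Ring R]

/-- The product of two two-sided ideals: the set of all finite sums of products `x * y` with
`x ∈ a` and `y ∈ b`. -/
def mul (a b : TwoSidedIdeal R) : TwoSidedIdeal R :=
  (a.asIdeal * b.asIdeal).toTwoSided

/-- The product contains the products of elements. -/
theorem mul_mem_mul {a b : TwoSidedIdeal R} {x y : R} (hx : x ∈ a) (hy : y ∈ b) :
    x * y ∈ mul a b := by
  rw [mul, Ideal.mem_toTwoSided]
  exact Ideal.mul_mem_mul (TwoSidedIdeal.mem_asIdeal.2 hx) (TwoSidedIdeal.mem_asIdeal.2 hy)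

/-- Universal property of the product of ideals. -/
theorem mul_le {a b c : TwoSidedIdeal R} :
    mul a b ≤ c ↔ ∀ x ∈ a, ∀ y ∈ b, x * y ∈ c := by
  constructor
  · intro h x hx y hy
    exact h (mul_mem_mul hx hy)
  · intro h z hz
    rw [mul, Ideal.mem_toTwoSided] at hz
    have : a.asIdeal * b.asIdeal ≤ c.asIdeal := by
      rw [Ideal.mul_le]
      intro r hr s hs
      exact TwoSidedIdeal.mem_asIdeal.2
        (h r (TwoSidedIdeal.mem_asIdeal.1 hr) s (TwoSidedIdeal.mem_asIdeal.1 hs))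
    exact TwoSidedIdeal.mem_asIdeal.1 (this hz)

/-- A two-sided ideal `p` of a ring is prime if it is proper and, for all two-sided ideals
`a`, `b`, the inclusion `a b ⊆ p` implies `a ⊆ p` or `b ⊆ p`. -/
def IsPrime (p : TwoSidedIdeal R) : Prop :=
  p ≠ ⊤ ∧ ∀ a b : TwoSidedIdeal R, mul a b ≤ p → a ≤ p ∨ b ≤ p

variable (R)

/-- A prime ring: the zero ideal is prime. -/
def IsPrimeRing : Prop := IsPrime (⊥ : TwoSidedIdeal R)

/-- The set of prime (two-sided) ideals, partially ordered by inclusion. -/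
abbrev Spec : Type _ := {p : TwoSidedIdeal R // IsPrime p}

/-- The classical Krull dimension: the supremum of the lengths of chains of prime ideals. -/
def classicalKrullDim : WithBot ℕ∞ := Order.krullDim (Spec R)

variable {R} in
/-- The height of a prime ideal `p`: the supremum of the lengths of chains of prime ideals
`p₀ ⊂ ⋯ ⊂ p_l = p`. -/
def height (p : Spec R) : ℕ∞ := Order.height p

/-- A ring of finite classical Krull dimension is catenary if, for all primes `p ⊆ q`, all
maximal chains of primes from `p` to `q` have the same length.  A finite chain from `p` to `q` is
maximal exactly when each of its steps is a covering relation in `Spec R`. -/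
def IsCatenary : Prop :=
  classicalKrullDim R < ⊤ ∧
    ∀ c d : RelSeries {(p, q) : Spec R × Spec R | p ⋖ q},
      c.head = d.head → c.last = d.last → c.length = d.length

end RingIdeal

/-! ## The algebra of polynomial integro-differential operators -/

namespace IntDiff

open MvPolynomial

variable (K : Type*) [Field K] (n : ℕ)

/-- The algebra of `K`-linear maps from `P_n = K[x_1, …, x_n]` to itself. -/
abbrev EndP : Type _ := Module.End K (MvPolynomial (Fin n) K)

variable {n}

/-- Multiplication by the variable `x_i`. -/
def mulX (i : Fin n) : EndP K n := LinearMap.mulLeft K (X i)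

/-- The partial derivative `∂ / ∂ x_i`. -/
def partialD (i : Fin n) : EndP K n := (pderiv i).toLinearMap

/-- The integration `∫_i`, with `x^α ↦ (α_i + 1)⁻¹ x_i x^α`. -/
def integ (i : Fin n) : EndP K n :=
  (basisMonomials (Fin n) K).constr K
    fun α => monomial (α + Finsupp.single i 1) (((α i : K) + 1)⁻¹)

variable (n)

/-- The algebra of polynomial integro-differential operators: the subalgebra of `End_K(P_n)`
generated by all `x_i`, `∂_i` and `∫_i`. -/
def algebraI : Subalgebra K (EndP K n) :=
  Algebra.adjoin K (Set.range (mulX K) ∪ Set.range (partialD K) ∪ Set.range (integ K))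

variable {n}

/-- `x_i` as an element of the algebra of integro-differential operators. -/
def x (i : Fin n) : algebraI K n :=
  ⟨mulX K i, Algebra.subset_adjoin (Or.inl (Or.inl ⟨i, rfl⟩))⟩

/-- `∂_i` as an element of the algebra of integro-differential operators. -/
def del (i : Fin n) : algebraI K n :=
  ⟨partialD K i, Algebra.subset_adjoin (Or.inl (Or.inr ⟨i, rfl⟩))⟩

/-- `∫_i` as an element of the algebra of integro-differential operators. -/
def int (i : Fin n) : algebraI K n :=
  ⟨integ K i, Algebra.subset_adjoin (Or.inr ⟨i, rfl⟩)⟩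

/-- The `i`-th tensor factor `K⟨x_i, ∂_i, ∫_i⟩`, a copy of the algebra for `n = 1`. -/
def factor (i : Fin n) : Subalgebra K (algebraI K n) :=
  Algebra.adjoin K {x K i, del K i, int K i}

/-- The matrix units `e_{st}(i) = ∫_i^s ∂_i^t - ∫_i^{s+1} ∂_i^{t+1}`. -/
def e (i : Fin n) (s t : ℕ) : algebraI K n :=
  int K i ^ s * del K i ^ t - int K i ^ (s + 1) * del K i ^ (t + 1)

/-- The ideal `F(i)` of the `i`-th tensor factor: the `K`-span of all `e_{st}(i)`. -/
def F (i : Fin n) : Submodule K (algebraI K n) :=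
  Submodule.span K (Set.range fun st : ℕ × ℕ => e K i st.1 st.2)

/-- The `i`-th factor of `I_f`: it is `F(i)` if `f i = 0` and `K⟨x_i, ∂_i, ∫_i⟩` if `f i = 1`. -/
def component (f : Fin n → Fin 2) (i : Fin n) : Submodule K (algebraI K n) :=
  if f i = 0 then F K i else Subalgebra.toSubmodule (factor K i)

/-- The pure tensors of `I_{f(1)} ⊗ ⋯ ⊗ I_{f(n)}`, i.e. the products `a_1 ⋯ a_n` with `a_i` in the
`i`-th component. -/
def pureTensors (f : Fin n → Fin 2) : Set (algebraI K n) :=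
  {z | ∃ a : Fin n → algebraI K n, (∀ i, a i ∈ component K f i) ∧ z = (List.ofFn a).prod}

/-- `I_{f(1)} ⊗ ⋯ ⊗ I_{f(n)}` as a subspace of the algebra of integro-differential operators (which
is the tensor product of its commuting subalgebras `factor K i`): the span of pure tensors. -/
def tensorSubspace (f : Fin n → Fin 2) : Submodule K (algebraI K n) :=
  Submodule.span K (pureTensors K f)

/-- `I_f = I_{f(1)} ⊗ ⋯ ⊗ I_{f(n)}` as a two-sided ideal. -/
def idealI (f : Fin n → Fin 2) : TwoSidedIdeal (algebraI K n) :=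
  TwoSidedIdeal.span (pureTensors K f)

/-- `𝔭_i`, the ideal with factor `F` in position `i` and the whole algebra in the others. -/
def p (i : Fin n) : TwoSidedIdeal (algebraI K n) :=
  idealI K fun j => if j = i then 0 else 1

variable (n) in
/-- The ideal `F_n = F ⊗ ⋯ ⊗ F`. -/
def Fn : TwoSidedIdeal (algebraI K n) := idealI K fun _ => 0

variable (n) in
/-- The ideal `𝔞_n = 𝔭_1 + ⋯ + 𝔭_n`. -/
def aMax : TwoSidedIdeal (algebraI K n) := ⨆ i, p K i

/-- The sum `𝔭_I` of the ideals `𝔭_i`, `i ∈ I`. -/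
def pSum (I : Finset (Fin n)) : TwoSidedIdeal (algebraI K n) := ⨆ i ∈ I, p K i

variable (n) in
/-- The set of all antichains in `{0,1}^n` (with the componentwise order). -/
abbrev Antichains : Type := {C : Set (Fin n → Fin 2) // IsAntichain (· ≤ ·) C}

variable (n) in
/-- The Dedekind number, the number of antichains in `{0,1}^n`. -/
def dedekindNumber : ℕ := Nat.card (Antichains n)

/-- The sum `I_C` of the ideals `I_f`, `f ∈ C`. -/
def idealOfAntichain (C : Antichains n) : TwoSidedIdeal (algebraI K n) :=
  ⨆ f ∈ C.1, idealI K f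

end IntDiff

end

/-! An ideal is determined by the idempotents `projProd K T` that it contains, one for each set `T`
of variables. In characteristic zero, `projProd K T` is the projection onto the monomials not
involving the variables in `T`, and an ideal containing it also contains `projProd K T'` for all `T'
⊇ T`. Two facts make this a complete description of the ideals.

Generation (`ideal_le_of_projProd_mem`): every ideal is generated by the `projProd K T` in it. In
one variable every element combines binomials in the Euler operator times powers of `∫` or `∂`, and
matrix units, with coefficients from the other variables. An ideal containing such a sum contains
the coefficients of the first kind, and `e_{00}` times each coefficient of the second kind
(`IsTriple.mem_of_sum_mem`). Treating the variables one after another leaves only scalar multiples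
of some `projProd K T`.

Separation (`le_vanishing_compl_iff`): the ideal `vanishing K Tᶜ` is the largest one omitting
`projProd K T`. Hence a sum of ideals contains `projProd K T` only if one of the summands does
(`projProd_mem_iSup`).

So ideals behave like up-sets of subsets of the variables: sums are unions, intersections are
intersections, and products equal intersections because each `projProd K T` is idempotent. The rest
is combinatorics. `I_f` corresponds to the sets containing all zeros of `f`, an up-set is recorded
by the antichain of its extreme members, and the primes are the ideals `𝔭_I`, corresponding to the
sets that meet `I`; they form a Boolean lattice. -/

noncomputable section

namespace IntDiff

/-! ## One pair of a derivation and an integration in an abstract algebra -/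

/-- The defining relations between a derivation `d`, an integration `J` and the Euler operator `h`
in one variable. -/
structure IsTriple {R : Type*} [Ring R] (d J h : R) : Prop where
  d_mul_J : d * J = 1
  d_mul_h : d * h = h * d + d
  h_mul_J : h * J = J * h + J
  h_mul_proj : h * (1 - J * d) = 0

/-- The binomial coefficient `h (h - 1) ⋯ (h - j + 1) / j!`. -/
def binom (K : Type*) {R : Type*} [Field K] [Ring R] [Algebra K R] (h : R) : ℕ → R
  | 0 => 1
  | j + 1 => ((j + 1 : K)⁻¹) • (binom K h j * (h - j))

/-- The matrix unit `J ^ s d ^ t - J ^ (s + 1) d ^ (t + 1)`. -/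
def matUnit {R : Type*} [Ring R] (d J : R) (s t : ℕ) : R :=
  J ^ s * d ^ t - J ^ (s + 1) * d ^ (t + 1)

/-- The operator `J ^ k` if `k ≥ 0`, and `d ^ (-k)` if `k ≤ 0`. -/
def shiftOp {R : Type*} [Ring R] (d J : R) (k : ℤ) : R := J ^ k.toNat * d ^ (-k).toNat

/-- A linear basis of the algebra generated by `d`, `J` and `h`. -/
def stdBasis (K : Type*) {R : Type*} [Field K] [Ring R] [Algebra K R] (d J h : R) :
    (ℤ × ℕ) ⊕ (ℕ × ℕ) → R
  | .inl kj => binom K h kj.2 * shiftOp d J kj.1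
  | .inr st => matUnit d J st.1 st.2

section

variable {K : Type*} {R : Type*} [Field K] [Ring R] [Algebra K R] {d J h : R}

/-- The middle factor is an idempotent killed by `d` from the left and by `J` from the right; all
matrix unit rules for a triple come from this factorization. -/
theorem matUnit_eq (s t : ℕ) : matUnit d J s t = J ^ s * (1 - J * d) * d ^ t := by
  rw [matUnit, pow_succ, pow_succ']; noncomm_ring

theorem commute_binom_of_commute {c : R} (hc : Commute c h) (j : ℕ) :
    Commute c (binom K h j) := by
  induction j with
  | zero => exact Commute.one_right _
  | succ j ih =>
    rw [binom]
    exact (ih.mul_right (hc.sub_right (Nat.cast_commute j c).symm)).smul_right _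

theorem commute_binom (j : ℕ) : Commute h (binom K h j) :=
  commute_binom_of_commute (Commute.refl h) j

theorem commute_stdBasis {c : R} (hd : Commute c d) (hJ : Commute c J) (hc : Commute c h)
    (i : (ℤ × ℕ) ⊕ (ℕ × ℕ)) : Commute c (stdBasis K d J h i) := by
  obtain ⟨k, j⟩ | ⟨s, t⟩ := i
  · exact (commute_binom_of_commute hc j).mul_right ((hJ.pow_right _).mul_right (hd.pow_right _))
  · exact ((hJ.pow_right _).mul_right (hd.pow_right _)).sub_right
      ((hJ.pow_right _).mul_right (hd.pow_right _))

theorem binom_mul_mem (W : Submodule K R) (hh : ∀ w ∈ W, h * w ∈ W) (j : ℕ) :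
    ∀ w ∈ W, binom K h j * w ∈ W := by
  induction j with
  | zero => intro w hw; simpa [binom] using hw
  | succ j ih =>
    intro w hw
    rw [binom, smul_mul_assoc, mul_assoc, sub_mul, ← nsmul_eq_mul]
    exact W.smul_mem _ (ih _ (W.sub_mem (hh w hw) (W.nsmul_mem hw j)))

theorem smul_binom_succ [CharZero K] (j : ℕ) :
    (j + 1 : K) • binom K h (j + 1) = binom K h j * (h - j) := by
  rw [binom, smul_smul, mul_inv_cancel₀ (Nat.cast_add_one_ne_zero j), one_smul]

theorem h_mul_binom [CharZero K] (j : ℕ) :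
    h * binom K h j = (j + 1 : K) • binom K h (j + 1) + (j : K) • binom K h j := by
  rw [smul_binom_succ, mul_sub, (commute_binom j).eq, Nat.cast_smul_eq_nsmul, nsmul_eq_mul,
    (Nat.cast_commute j (binom K h j)).eq]
  abel

/-- By Pascal's rule this is the recursion for the binomials of `h + 1`; it is the inductive step of
both `d_mul_binom` and `binom_mul_J`. -/
theorem binom_mul_sub [CharZero K] (j : ℕ) : binom K h (j + 1) * (h - j) + binom K h j * (h - j) =
    (j + 2 : K) • (binom K h (j + 2) + binom K h (j + 1)) := by
  have h1 := smul_binom_succ (K := K) (h := h) (j + 1)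
  rw [← smul_binom_succ j]
  have h2 : binom K h (j + 1) * (h - j) =
      binom K h (j + 1) * (h - (j + 1 : ℕ)) + binom K h (j + 1) := by
    push_cast; noncomm_ring
  rw [h2, ← h1]
  push_cast
  module

/-! ### Commutation rules and a spanning set for one triple -/

namespace IsTriple

theorem d_mul_sub (T : IsTriple d J h) (c : ℕ) : d * (h - (c + 1 : ℕ)) = (h - c) * d := by
  have : d * (c : R) = c * d := (Nat.cast_commute c d).symm.eq
  push_cast
  rw [mul_sub, T.d_mul_h, mul_add, this]; noncomm_ring

theorem sub_mul_J (T : IsTriple d J h) (c : ℕ) : (h - (c + 1 : ℕ)) * J = J * (h - c) := by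
  have : J * (c : R) = c * J := (Nat.cast_commute c J).symm.eq
  push_cast
  rw [sub_mul, T.h_mul_J, add_mul, mul_sub, this]; noncomm_ring

/-- Moving `d` to the right replaces `h` by `h + 1`, and Pascal's rule expands the shifted binomial.
-/
theorem d_mul_binom [CharZero K] (T : IsTriple d J h) (j : ℕ) :
    d * binom K h (j + 1) = (binom K h (j + 1) + binom K h j) * d := by
  induction j with
  | zero => simp [binom, T.d_mul_h, add_mul]
  | succ j ih =>
    have hj : ((j : K) + 2) ≠ 0 := by exact_mod_cast (Nat.succ_ne_zero (j + 1))
    refine smul_right_injective R hj ?_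
    have h1 : (j + 2 : K) • binom K h (j + 2) = binom K h (j + 1) * (h - (j + 1 : ℕ)) := by
      rw [← smul_binom_succ (j + 1)]; push_cast; congr 1; ring
    simp only
    rw [← mul_smul_comm, h1, ← mul_assoc, ih, mul_assoc, T.d_mul_sub, ← mul_assoc, add_mul,
      binom_mul_sub, smul_mul_assoc]

theorem binom_mul_J [CharZero K] (T : IsTriple d J h) (j : ℕ) :
    binom K h (j + 1) * J = J * (binom K h (j + 1) + binom K h j) := by
  induction j with
  | zero => simp [binom, T.h_mul_J, mul_add]
  | succ j ih =>
    have hj : ((j : K) + 2) ≠ 0 := by exact_mod_cast (Nat.succ_ne_zero (j + 1))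
    refine smul_right_injective R hj ?_
    have h1 : (j + 2 : K) • binom K h (j + 2) = binom K h (j + 1) * (h - (j + 1 : ℕ)) := by
      rw [← smul_binom_succ (j + 1)]; push_cast; congr 1; ring
    simp only
    rw [← smul_mul_assoc, h1, mul_assoc, T.sub_mul_J, ← mul_assoc, ih, mul_assoc, add_mul,
      binom_mul_sub, mul_smul_comm]

theorem d_mul_proj (T : IsTriple d J h) : d * (1 - J * d) = 0 := by
  rw [mul_sub, mul_one, ← mul_assoc, T.d_mul_J, one_mul, sub_self]

theorem proj_mul_J (T : IsTriple d J h) : (1 - J * d) * J = 0 := by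
  rw [sub_mul, one_mul, mul_assoc, T.d_mul_J, mul_one, sub_self]

theorem proj_mul_proj (T : IsTriple d J h) : (1 - J * d) * (1 - J * d) = 1 - J * d := by
  rw [mul_sub, mul_one, ← mul_assoc, T.proj_mul_J, zero_mul, sub_zero]

theorem d_pow_mul_J_pow (T : IsTriple d J h) (m : ℕ) : d ^ m * J ^ m = 1 := by
  induction m with
  | zero => simp
  | succ m ih =>
    rw [pow_succ, pow_succ', mul_assoc, ← mul_assoc d, T.d_mul_J, one_mul, ih]

theorem h_mul_J_pow (T : IsTriple d J h) (m : ℕ) : h * J ^ m = J ^ m * h + m * J ^ m := by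
  induction m with
  | zero => simp
  | succ m ih =>
    rw [pow_succ, ← mul_assoc, ih, add_mul, mul_assoc, T.h_mul_J]
    push_cast
    noncomm_ring

/-- This is the multiplication rule of matrix units: `d ^ t * J ^ u` cancels to a power of `d` or of
`J`, and a positive power is annihilated by the adjacent idempotent. -/
theorem proj_d_pow_J_pow_proj (T : IsTriple d J h) (t u : ℕ) :
    (1 - J * d) * d ^ t * (J ^ u * (1 - J * d)) = if t = u then 1 - J * d else 0 := by
  rcases lt_trichotomy t u with htu | rfl | htu
  · obtain ⟨k, rfl⟩ := Nat.exists_eq_add_of_lt htu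
    rw [if_neg (by omega), add_assoc, pow_add, mul_assoc, mul_assoc, ← mul_assoc (d ^ t),
      T.d_pow_mul_J_pow, one_mul, pow_succ', mul_assoc, ← mul_assoc, T.proj_mul_J, zero_mul]
  · rw [if_pos rfl, mul_assoc, ← mul_assoc (d ^ t), T.d_pow_mul_J_pow, one_mul, T.proj_mul_proj]
  · obtain ⟨k, rfl⟩ := Nat.exists_eq_add_of_lt htu
    rw [if_neg (by omega), show u + k + 1 = k + 1 + u by ring, pow_add, mul_assoc, mul_assoc,
      ← mul_assoc (d ^ u), T.d_pow_mul_J_pow, one_mul, pow_succ, mul_assoc, T.d_mul_proj,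
      mul_zero, mul_zero]

theorem d_mul_matUnit_zero (T : IsTriple d J h) (t : ℕ) : d * matUnit d J 0 t = 0 := by
  rw [matUnit_eq, pow_zero, one_mul, ← mul_assoc, T.d_mul_proj, zero_mul]

theorem d_mul_matUnit_succ (T : IsTriple d J h) (s t : ℕ) :
    d * matUnit d J (s + 1) t = matUnit d J s t := by
  rw [matUnit_eq, matUnit_eq, pow_succ', mul_assoc, mul_assoc, ← mul_assoc d, T.d_mul_J, one_mul,
    mul_assoc]

theorem matUnit_zero_mul_J (T : IsTriple d J h) (s : ℕ) : matUnit d J s 0 * J = 0 := by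
  rw [matUnit_eq, pow_zero, mul_one, mul_assoc, T.proj_mul_J, mul_zero]

theorem matUnit_succ_mul_J (T : IsTriple d J h) (s t : ℕ) :
    matUnit d J s (t + 1) * J = matUnit d J s t := by
  rw [matUnit_eq, matUnit_eq, pow_succ, mul_assoc, mul_assoc (d ^ t), T.d_mul_J, mul_one]

theorem matUnit_mul_d (s t : ℕ) :
    matUnit d J s t * d = matUnit d J s (t + 1) := by
  rw [matUnit_eq, matUnit_eq, mul_assoc, pow_succ]

theorem J_mul_matUnit (s t : ℕ) :
    J * matUnit d J s t = matUnit d J (s + 1) t := by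
  rw [matUnit_eq, matUnit_eq, ← mul_assoc, ← mul_assoc, pow_succ']

theorem h_mul_matUnit (T : IsTriple d J h) (s t : ℕ) :
    h * matUnit d J s t = s * matUnit d J s t := by
  rw [matUnit_eq, ← mul_assoc, ← mul_assoc, T.h_mul_J_pow, add_mul, mul_assoc _ h, T.h_mul_proj,
    mul_zero, zero_add, mul_assoc, mul_assoc, mul_assoc]

/-- The relations make `h` commute with `J * d`, so this is the mirror image of `h_mul_proj`. -/
theorem proj_mul_h (T : IsTriple d J h) : (1 - J * d) * h = 0 := by
  rw [← T.h_mul_proj, sub_mul, mul_sub, mul_assoc, T.d_mul_h, ← mul_assoc h, T.h_mul_J]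
  noncomm_ring

theorem d_pow_mul_h (T : IsTriple d J h) (m : ℕ) : d ^ m * h = h * d ^ m + m * d ^ m := by
  induction m with
  | zero => simp
  | succ m ih =>
    have : d * (m : R) = m * d := (Nat.cast_commute m d).symm.eq
    rw [pow_succ', mul_assoc, ih, mul_add, ← mul_assoc, T.d_mul_h, ← mul_assoc, this]
    push_cast
    noncomm_ring

theorem matUnit_mul_h (T : IsTriple d J h) (s t : ℕ) :
    matUnit d J s t * h = t * matUnit d J s t := by
  have : ∀ a : R, a * (t : R) = t * a := fun a => (Nat.cast_commute t a).symm.eq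
  rw [matUnit_eq, mul_assoc, T.d_pow_mul_h, mul_add, ← mul_assoc, mul_assoc _ _ h, T.proj_mul_h,
    mul_zero, zero_mul, zero_add, ← mul_assoc, this, mul_assoc]

theorem matUnit_mul_J_pow (T : IsTriple d J h) (s t N : ℕ) (hN : t < N) :
    matUnit d J s t * J ^ N = 0 := by
  induction t generalizing N with
  | zero =>
    obtain ⟨N, rfl⟩ := Nat.exists_eq_add_of_lt hN
    rw [pow_succ', ← mul_assoc, T.matUnit_zero_mul_J, zero_mul]
  | succ t ih =>
    cases N with
    | zero => omega
    | succ N => rw [pow_succ', ← mul_assoc, T.matUnit_succ_mul_J, ih _ (by omega)]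

theorem d_mul_shiftOp (T : IsTriple d J h) (k : ℤ) : d * shiftOp d J k = shiftOp d J (k - 1) := by
  unfold shiftOp
  rcases le_or_gt k 0 with hk | hk
  · rw [show k.toNat = 0 by omega, show (k - 1).toNat = 0 by omega,
      show (-(k - 1)).toNat = (-k).toNat + 1 by omega, pow_zero, one_mul, one_mul, pow_succ']
  · rw [show k.toNat = (k - 1).toNat + 1 by omega, show (-k).toNat = 0 by omega,
      show (-(k - 1)).toNat = 0 by omega, pow_zero, mul_one, mul_one, pow_succ', ← mul_assoc,
      T.d_mul_J, one_mul]

theorem J_mul_shiftOp_of_nonneg {k : ℤ} (hk : 0 ≤ k) :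
    J * shiftOp d J k = shiftOp d J (k + 1) := by
  unfold shiftOp
  rw [show (k + 1).toNat = k.toNat + 1 by omega, show (-k).toNat = 0 by omega,
    show (-(k + 1)).toNat = 0 by omega, pow_succ', mul_assoc]

/-- `J` is only a right inverse of `d`; the defect `1 - J * d` is what brings matrix units into the
spanning set. -/
theorem J_mul_shiftOp_of_neg {k : ℤ} (hk : k < 0) :
    J * shiftOp d J k = shiftOp d J (k + 1) - matUnit d J 0 (-(k + 1)).toNat := by
  unfold shiftOp
  rw [matUnit_eq, show (k + 1).toNat = 0 by omega, show k.toNat = 0 by omega,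
    show (-k).toNat = (-(k + 1)).toNat + 1 by omega, pow_succ']
  noncomm_ring

theorem shiftOp_mul_J_pow (T : IsTriple d J h) {k : ℤ} {N : ℕ} (hk : 0 ≤ k + N) :
    shiftOp d J k * J ^ N = J ^ (k + N).toNat := by
  unfold shiftOp
  rcases le_or_gt k 0 with h0 | h0
  · rw [show k.toNat = 0 by omega, show N = (-k).toNat + (k + N).toNat by omega, pow_add,
      ← mul_assoc, pow_zero, one_mul, T.d_pow_mul_J_pow, one_mul]
    congr 1; omega
  · rw [show (-k).toNat = 0 by omega, pow_zero, mul_one, ← pow_add]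
    congr 1; omega

/-- The span of the standard basis is stable under left multiplication by the Euler operator. -/
theorem h_mul_mem_span [CharZero K] (T : IsTriple d J h) :
    ∀ w ∈ Submodule.span K (Set.range (stdBasis K d J h)),
      h * w ∈ Submodule.span K (Set.range (stdBasis K d J h)) := by
  intro w hw
  induction hw using Submodule.span_induction with
  | mem w hw =>
    obtain ⟨⟨k, j⟩ | ⟨s, t⟩, rfl⟩ := hw
    · have e1 : h * stdBasis K d J h (.inl (k, j)) = (j + 1 : K) • stdBasis K d J h (.inl (k, j + 1))
          + (j : K) • stdBasis K d J h (.inl (k, j)) := by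
        simp only [stdBasis]
        rw [← mul_assoc, h_mul_binom, add_mul, smul_mul_assoc, smul_mul_assoc]
      rw [e1]
      exact add_mem (Submodule.smul_mem _ _ (Submodule.subset_span ⟨_, rfl⟩))
        (Submodule.smul_mem _ _ (Submodule.subset_span ⟨_, rfl⟩))
    · have e1 : h * stdBasis K d J h (.inr (s, t)) = s • stdBasis K d J h (.inr (s, t)) := by
        simp only [stdBasis]
        rw [T.h_mul_matUnit, nsmul_eq_mul]
      rw [e1]
      exact Submodule.smul_of_tower_mem _ _ (Submodule.subset_span ⟨_, rfl⟩)
  | zero => simp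
  | add x y _ _ hx hy => rw [mul_add]; exact add_mem hx hy
  | smul a x _ hx => rw [mul_smul_comm]; exact Submodule.smul_mem _ _ hx

theorem d_mul_mem_span [CharZero K] (T : IsTriple d J h) :
    ∀ w ∈ Submodule.span K (Set.range (stdBasis K d J h)),
      d * w ∈ Submodule.span K (Set.range (stdBasis K d J h)) := by
  intro w hw
  induction hw using Submodule.span_induction with
  | mem w hw =>
    obtain ⟨⟨k, j⟩ | ⟨s, t⟩, rfl⟩ := hw
    · cases j with
      | zero =>
        refine Submodule.subset_span ⟨.inl (k - 1, 0), ?_⟩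
        simp [stdBasis, binom, T.d_mul_shiftOp]
      | succ j =>
        have e1 : d * stdBasis K d J h (.inl (k, j + 1)) =
            stdBasis K d J h (.inl (k - 1, j + 1)) + stdBasis K d J h (.inl (k - 1, j)) := by
          simp only [stdBasis]
          rw [← mul_assoc, T.d_mul_binom, mul_assoc, T.d_mul_shiftOp, add_mul]
        rw [e1]
        exact add_mem (Submodule.subset_span ⟨_, rfl⟩) (Submodule.subset_span ⟨_, rfl⟩)
    · cases s with
      | zero => simp [stdBasis, T.d_mul_matUnit_zero]
      | succ s =>
        refine Submodule.subset_span ⟨.inr (s, t), ?_⟩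
        simp [stdBasis, T.d_mul_matUnit_succ]
  | zero => simp
  | add x y _ _ hx hy => rw [mul_add]; exact add_mem hx hy
  | smul a x _ hx => rw [mul_smul_comm]; exact Submodule.smul_mem _ _ hx

theorem J_mul_shiftOp_mem_span (k : ℤ) :
    J * shiftOp d J k ∈ Submodule.span K (Set.range (stdBasis K d J h)) := by
  have h1 : shiftOp d J (k + 1) ∈ Submodule.span K (Set.range (stdBasis K d J h)) :=
    Submodule.subset_span ⟨.inl (k + 1, 0), by simp [stdBasis, binom]⟩
  rcases le_or_gt 0 k with hk | hk
  · rw [J_mul_shiftOp_of_nonneg hk]; exact h1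
  · rw [J_mul_shiftOp_of_neg hk]
    exact sub_mem h1 (Submodule.subset_span ⟨.inr (0, _), rfl⟩)

theorem J_mul_mem_span [CharZero K] (T : IsTriple d J h) :
    ∀ w ∈ Submodule.span K (Set.range (stdBasis K d J h)),
      J * w ∈ Submodule.span K (Set.range (stdBasis K d J h)) := by
  intro w hw
  induction hw using Submodule.span_induction with
  | mem w hw =>
    obtain ⟨⟨k, j⟩ | ⟨s, t⟩, rfl⟩ := hw
    · simp only [stdBasis]
      induction j with
      | zero => simpa [binom] using J_mul_shiftOp_mem_span k
      | succ j ih =>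
        -- Moving `J` past the binomial costs a term of lower degree, covered by the induction;
        -- binomials in `h` preserve the span.
        have e1 : J * binom K h (j + 1) = binom K h (j + 1) * J - J * binom K h j := by
          rw [T.binom_mul_J]; noncomm_ring
        rw [← mul_assoc, e1, sub_mul, mul_assoc, mul_assoc]
        exact sub_mem (binom_mul_mem _ T.h_mul_mem_span _ _ (J_mul_shiftOp_mem_span k)) ih
    · refine Submodule.subset_span ⟨.inr (s + 1, t), ?_⟩
      simp [stdBasis, J_mul_matUnit]
  | zero => simp
  | add x y _ _ hx hy => rw [mul_add]; exact add_mem hx hy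
  | smul a x _ hx => rw [mul_smul_comm]; exact Submodule.smul_mem _ _ hx

end IsTriple

/-! ## Separation of coefficients -/

/-- A subspace stable under an endomorphism contains each of the eigenvectors with distinct
eigenvalues whose sum it contains. -/
theorem mem_of_sum_eigenvectors_mem {V ι : Type*} [AddCommGroup V] [Module K V]
    (M : Submodule K V) (T : V →ₗ[K] V) (hT : ∀ v ∈ M, T v ∈ M) (μ : ι → K) (s : Finset ι)
    (hμ : Set.InjOn μ s) (v : ι → V) (hv : ∀ i ∈ s, T (v i) = μ i • v i)
    (hs : ∑ i ∈ s, v i ∈ M) : ∀ i ∈ s, v i ∈ M := by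
  classical
  induction s using Finset.induction_on generalizing v with
  | empty => simp
  | insert a s ha ih =>
    have key : ∀ i ∈ s, v i ∈ M := by
      intro i hi
      have h1 : (μ i - μ a) • v i ∈ M := by
        refine ih (hμ.mono (by simp)) (fun i => (μ i - μ a) • v i) ?_ ?_ i hi
        · intro i hi
          rw [map_smul, hv i (by simp [hi]), smul_comm]
        -- Applying `T - μ a` removes `v a` and scales every other term by a nonzero factor.
        · have h2 : T (∑ i ∈ insert a s, v i) - μ a • ∑ i ∈ insert a s, v i ∈ M :=
            M.sub_mem (hT _ hs) (M.smul_mem _ hs)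
          rw [Finset.sum_insert ha, map_add, map_sum, hv a (by simp), smul_add, Finset.smul_sum,
            add_sub_add_left_eq_sub, ← Finset.sum_sub_distrib] at h2
          convert h2 using 2 with i hi
          rw [hv _ (by simp [hi]), sub_smul]
      have hne : μ i - μ a ≠ 0 := by
        rw [sub_ne_zero]
        intro heq
        exact ha (hμ (by simp [hi]) (by simp) heq ▸ hi)
      exact (M.smul_mem_iff hne).1 h1
    intro i hi
    rcases Finset.mem_insert.1 hi with rfl | hi
    · rw [Finset.sum_insert ha] at hs
      exact (M.add_mem_iff_left (M.sum_mem key)).1 hs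
    · exact key i hi

/-- A subspace is stable under left and right multiplication by `d`, `J` and `h`. -/
structure IsStable (M : Submodule K R) (d J h : R) : Prop where
  d_mul : ∀ v ∈ M, d * v ∈ M
  J_mul : ∀ v ∈ M, J * v ∈ M
  h_mul : ∀ v ∈ M, h * v ∈ M
  mul_d : ∀ v ∈ M, v * d ∈ M
  mul_J : ∀ v ∈ M, v * J ∈ M
  mul_h : ∀ v ∈ M, v * h ∈ M

theorem IsStable.pow_mul {M : Submodule K R} {r : R} (hr : ∀ v ∈ M, r * v ∈ M) (m : ℕ) :
    ∀ v ∈ M, r ^ m * v ∈ M := by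
  induction m with
  | zero => intro v hv; simpa using hv
  | succ m ih => intro v hv; rw [pow_succ, mul_assoc]; exact ih _ (hr v hv)

theorem IsStable.mul_pow {M : Submodule K R} {r : R} (hr : ∀ v ∈ M, v * r ∈ M) (m : ℕ) :
    ∀ v ∈ M, v * r ^ m ∈ M := by
  induction m with
  | zero => intro v hv; simpa using hv
  | succ m ih => intro v hv; rw [pow_succ, ← mul_assoc]; exact hr _ (ih v hv)

namespace IsTriple

/-- The map `v ↦ d * v * J - v` acts as a difference operator in `h`: on these terms it lowers the
index of the binomial by one and kills index zero. Induction on `N` thus yields all coefficients but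
`c 0`, which remains after subtraction and is freed from `J ^ m` by `d ^ m`. -/
theorem mem_of_sum_binom_mem [CharZero K] (T : IsTriple d J h) {M : Submodule K R}
    (hM : IsStable M d J h) (m N : ℕ) (c : ℕ → R) (hc : ∀ j, Commute (c j) J)
    (hs : ∑ j ∈ Finset.range N, binom K h j * J ^ m * c j ∈ M) : ∀ j < N, c j ∈ M := by
  induction N generalizing c with
  | zero => simp
  | succ N ih =>
    have h1 : ∀ j < N, c (j + 1) ∈ M := by
      refine ih (fun j => c (j + 1)) (fun j => hc _) ?_
      have h2 := M.sub_mem (hM.mul_J _ (hM.d_mul _ hs)) hs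
      rw [Finset.mul_sum, Finset.sum_mul, ← Finset.sum_sub_distrib, Finset.sum_range_succ'] at h2
      have h3 : ∀ j, d * (binom K h (j + 1) * J ^ m * c (j + 1)) * J -
          binom K h (j + 1) * J ^ m * c (j + 1) = binom K h j * J ^ m * c (j + 1) := by
        intro j
        rw [mul_assoc d, mul_assoc _ _ J, (hc _).eq, mul_assoc (binom K h (j + 1)), ← mul_assoc,
          T.d_mul_binom, ← mul_assoc _ J, ← pow_succ, pow_succ', mul_assoc _ d, ← mul_assoc d,
          ← mul_assoc d, T.d_mul_J, one_mul]
        noncomm_ring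
      have h4 : d * (binom K h 0 * J ^ m * c 0) * J - binom K h 0 * J ^ m * c 0 = 0 := by
        rw [binom, one_mul, mul_assoc d, mul_assoc _ _ J, (hc _).eq, ← mul_assoc _ J,
          ← pow_succ, pow_succ', ← mul_assoc d, ← mul_assoc d, T.d_mul_J, one_mul, sub_self]
      rw [h4, add_zero] at h2
      simpa only [h3] using h2
    have h0 : c 0 ∈ M := by
      rw [Finset.sum_range_succ'] at hs
      have h2 : ∑ j ∈ Finset.range N, binom K h (j + 1) * J ^ m * c (j + 1) ∈ M := by
        refine M.sum_mem fun j hj => ?_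
        rw [mul_assoc]
        exact binom_mul_mem M hM.h_mul _ _ (IsStable.pow_mul hM.J_mul _ _
          (h1 j (Finset.mem_range.1 hj)))
      have h3 := IsStable.pow_mul hM.d_mul m _ ((M.add_mem_iff_right h2).1 hs)
      rwa [binom, one_mul, ← mul_assoc, T.d_pow_mul_J_pow, one_mul] at h3
    intro j hj
    cases j with
    | zero => exact h0
    | succ j => exact h1 j (by omega)

/-- Right multiplication by a high power of `J` kills the matrix units and turns all shifts into
powers of `J`; commutation with `h` separates these powers, and `mem_of_sum_binom_mem` separates the
binomials. Only then are the matrix units isolated. -/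
theorem mem_of_sum_mem [CharZero K] (T : IsTriple d J h) {M : Submodule K R}
    (hM : IsStable M d J h) (s : Finset ℤ) (A B : ℕ) (c : ℤ × ℕ → R) (c' : ℕ × ℕ → R)
    (hcJ : ∀ i, Commute (c i) J) (hch : ∀ i, Commute (c i) h)
    (hcJ' : ∀ i, Commute (c' i) J) (hcd' : ∀ i, Commute (c' i) d)
    (hs : ∑ k ∈ s, ∑ j ∈ Finset.range A, stdBasis K d J h (.inl (k, j)) * c (k, j) +
      ∑ i ∈ Finset.range B ×ˢ Finset.range B, stdBasis K d J h (.inr i) * c' i ∈ M) :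
    (∀ k ∈ s, ∀ j < A, c (k, j) ∈ M) ∧
      ∀ i ∈ Finset.range B ×ˢ Finset.range B, matUnit d J 0 0 * c' i ∈ M := by
  have h1 : ∀ k ∈ s, ∀ j < A, c (k, j) ∈ M := by
    obtain ⟨N, hBN, hN⟩ : ∃ N : ℕ, B ≤ N ∧ ∀ k ∈ s, 0 ≤ k + N := by
      -- The summand `B` lets `J ^ N` kill the matrix units; the absolute values make every exponent
      -- `k + N` nonnegative.
      refine ⟨B + ∑ k ∈ s, k.natAbs, by omega, fun k hk => ?_⟩
      have := Finset.single_le_sum (f := Int.natAbs) (fun _ _ => Nat.zero_le _) hk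
      omega
    have h2 := IsStable.mul_pow hM.mul_J N _ hs
    have h3 : (∑ i ∈ Finset.range B ×ˢ Finset.range B, stdBasis K d J h (.inr i) * c' i) * J ^ N
        = 0 := by
      rw [Finset.sum_mul]
      refine Finset.sum_eq_zero fun i hi => ?_
      rw [Finset.mem_product, Finset.mem_range, Finset.mem_range] at hi
      rw [mul_assoc, ((hcJ' i).pow_right N).eq, ← mul_assoc]
      simp only [stdBasis]
      rw [T.matUnit_mul_J_pow _ _ _ (by omega), zero_mul]
    have h4 : (∑ k ∈ s, ∑ j ∈ Finset.range A, stdBasis K d J h (.inl (k, j)) * c (k, j)) * J ^ N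
        = ∑ k ∈ s, ∑ j ∈ Finset.range A, binom K h j * J ^ (k + N).toNat * c (k, j) := by
      rw [Finset.sum_mul]
      refine Finset.sum_congr rfl fun k hk => ?_
      rw [Finset.sum_mul]
      refine Finset.sum_congr rfl fun j _ => ?_
      simp only [stdBasis]
      rw [mul_assoc, ((hcJ _).pow_right N).eq, ← mul_assoc, mul_assoc (binom K h j),
        T.shiftOp_mul_J_pow (hN k hk)]
    rw [add_mul, h3, add_zero, h4] at h2
    -- The commutator with `h` has eigenvalue `k + N` on the terms containing `J ^ (k + N)`;
    -- characteristic zero keeps these eigenvalues distinct.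
    have h5 := mem_of_sum_eigenvectors_mem M (LinearMap.mulLeft K h - LinearMap.mulRight K h)
      (fun v hv => M.sub_mem (hM.h_mul v hv) (hM.mul_h v hv)) (fun k : ℤ => ((k + N : ℤ) : K)) s
      (fun a _ b _ hab => by simpa using hab) _ (fun k hk => ?_) h2
    · intro k hk j hj
      exact T.mem_of_sum_binom_mem hM _ _ (fun j => c (k, j)) (fun j => hcJ _) (h5 k hk) j hj
    · have e1 : ((k + N : ℤ) : K) = (((k + N).toNat : ℕ) : K) := by
        rw [← Int.cast_natCast (R := K), Int.toNat_of_nonneg (hN k hk)]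
      rw [e1, Nat.cast_smul_eq_nsmul, map_sum, Finset.smul_sum]
      refine Finset.sum_congr rfl fun j _ => ?_
      rw [LinearMap.sub_apply, LinearMap.mulLeft_apply, LinearMap.mulRight_apply, mul_assoc _ _ h,
        (hch _).eq, ← mul_assoc, ← mul_assoc, (commute_binom j).eq, mul_assoc _ h, T.h_mul_J_pow,
        ← mul_assoc _ h, ← sub_mul, mul_add, mul_assoc _ _ h, add_sub_cancel_left, nsmul_eq_mul,
        ← mul_assoc, ← (Nat.cast_commute _ (binom K h j)).eq, mul_assoc, mul_assoc, mul_assoc]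
  refine ⟨h1, ?_⟩
  have h2 : ∑ k ∈ s, ∑ j ∈ Finset.range A, stdBasis K d J h (.inl (k, j)) * c (k, j) ∈ M := by
    refine M.sum_mem fun k hk => M.sum_mem fun j hj => ?_
    simp only [stdBasis, shiftOp]
    rw [mul_assoc, mul_assoc]
    exact binom_mul_mem M hM.h_mul _ _ (IsStable.pow_mul hM.J_mul _ _
      (IsStable.pow_mul hM.d_mul _ _ (h1 k hk j (Finset.mem_range.1 hj))))
  have h3 := (M.add_mem_iff_right h2).1 hs
  rintro ⟨a, b⟩ hi
  have hP : ∀ v ∈ M, (1 - J * d) * v ∈ M := fun v hv => by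
    rw [sub_mul, one_mul, mul_assoc]; exact M.sub_mem hv (hM.J_mul _ (hM.d_mul _ hv))
  have hP' : ∀ v ∈ M, v * (1 - J * d) ∈ M := fun v hv => by
    rw [mul_sub, mul_one, ← mul_assoc]; exact M.sub_mem hv (hM.mul_d _ (hM.mul_J _ hv))
  -- Multiplying by `e_{0a}` on the left and by `e_{b0}` on the right picks out the `(a, b)` entry
  -- and moves it to position `(0, 0)`.
  have h4 := hP' _ (IsStable.mul_pow hM.mul_J b _ (hP _ (IsStable.pow_mul hM.d_mul a _ h3)))
  rw [Finset.mul_sum, Finset.mul_sum, Finset.sum_mul, Finset.sum_mul,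
    Finset.sum_eq_single (a, b)] at h4
  · have hcc : Commute (c' (a, b)) (J ^ b * (1 - J * d)) :=
      ((hcJ' _).pow_right b).mul_right
        ((Commute.one_right _).sub_right ((hcJ' _).mul_right (hcd' _)))
    convert h4 using 1
    simp only [stdBasis, matUnit_eq, pow_zero, one_mul, mul_one]
    have e1 := T.proj_d_pow_J_pow_proj a a
    have e2 := T.proj_d_pow_J_pow_proj b b
    rw [if_pos rfl] at e1 e2
    calc (1 - J * d) * c' (a, b)
        = ((1 - J * d) * d ^ a * (J ^ a * (1 - J * d))) * d ^ b * (J ^ b * (1 - J * d)) *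
          c' (a, b) := by rw [e1, e2]
      _ = (1 - J * d) * d ^ a * (J ^ a * (1 - J * d) * d ^ b) * ((J ^ b * (1 - J * d)) *
          c' (a, b)) := by simp only [mul_assoc]
      _ = _ := by rw [← hcc.eq]; simp only [mul_assoc]
  · rintro ⟨s', t'⟩ _ hne
    have hcc : Commute (c' (s', t')) (J ^ b * (1 - J * d)) :=
      ((hcJ' _).pow_right b).mul_right
        ((Commute.one_right _).sub_right ((hcJ' _).mul_right (hcd' _)))
    simp only [stdBasis, matUnit_eq]
    calc (1 - J * d) * (d ^ a * (J ^ s' * (1 - J * d) * d ^ t' * c' (s', t'))) * J ^ b *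
          (1 - J * d)
        = (1 - J * d) * d ^ a * (J ^ s' * (1 - J * d) * d ^ t') *
          (c' (s', t') * (J ^ b * (1 - J * d))) := by simp only [mul_assoc]
      _ = ((1 - J * d) * d ^ a * (J ^ s' * (1 - J * d))) * (d ^ t' * (J ^ b * (1 - J * d))) *
          c' (s', t') := by rw [hcc.eq]; simp only [mul_assoc]
      _ = 0 := by
        rw [T.proj_d_pow_J_pow_proj]
        split_ifs with h6
        · rw [← mul_assoc, T.proj_d_pow_J_pow_proj, if_neg, zero_mul]
          rintro rfl
          exact hne (by rw [h6])
        · rw [zero_mul, zero_mul]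
  · exact fun hn => absurd hi hn

/-- Every element of the algebra generated by one triple and a subalgebra `C` commuting with it
is a combination of the standard basis with coefficients in `C`. -/
theorem exists_eq_sum [CharZero K] (T : IsTriple d J h) (C : Subalgebra K R)
    (hCd : ∀ c ∈ C, Commute c d) (hCJ : ∀ c ∈ C, Commute c J) (hCh : ∀ c ∈ C, Commute c h)
    {u : R} (hu : u ∈ Algebra.adjoin K ({J * h + J, d, J} ∪ (C : Set R))) :
    ∃ (s : Finset ℤ) (A B : ℕ) (c : ℤ × ℕ → R) (c' : ℕ × ℕ → R),
      (∀ i, c i ∈ C) ∧ (∀ i, c' i ∈ C) ∧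
      u = ∑ k ∈ s, ∑ j ∈ Finset.range A, stdBasis K d J h (.inl (k, j)) * c (k, j) +
        ∑ i ∈ Finset.range B ×ˢ Finset.range B, stdBasis K d J h (.inr i) * c' i := by
  classical
  set W₀ := Submodule.span K (Set.range (stdBasis K d J h)) with hW₀
  -- `W` contains `1` and is stable under left multiplication by every generator, hence contains
  -- `u`.
  set W : Submodule K R := W₀ * Subalgebra.toSubmodule C with hW
  have hone : (1 : R) ∈ W := by
    rw [← mul_one (1 : R)]
    refine Submodule.mul_mem_mul (Submodule.subset_span ⟨.inl (0, 0), ?_⟩) C.one_mem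
    simp [stdBasis, binom, shiftOp]
  have hleft : ∀ r : R, (∀ w ∈ W₀, r * w ∈ W₀) → ∀ w ∈ W, r * w ∈ W := by
    intro r hr w hw
    induction hw using Submodule.mul_induction_on' with
    | mem_mul_mem m hm c hc => rw [← mul_assoc]; exact Submodule.mul_mem_mul (hr m hm) hc
    | add y _ z _ hy hz => rw [mul_add]; exact add_mem hy hz
  have hWd := hleft d T.d_mul_mem_span
  have hWJ := hleft J T.J_mul_mem_span
  have hWh := hleft h T.h_mul_mem_span
  have hCW₀ : ∀ c ∈ C, ∀ m ∈ W₀, Commute c m := by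
    intro c hc m hm
    induction hm using Submodule.span_induction with
    | mem w hw =>
      obtain ⟨i, rfl⟩ := hw
      exact commute_stdBasis (hCd c hc) (hCJ c hc) (hCh c hc) i
    | zero => exact Commute.zero_right _
    | add y z _ _ hy hz => exact hy.add_right hz
    | smul a y _ hy => exact hy.smul_right a
  have hCW : ∀ c ∈ C, ∀ w ∈ W, c * w ∈ W := by
    intro c hc w hw
    induction hw using Submodule.mul_induction_on' with
    | mem_mul_mem m hm c' hc' =>
      rw [← mul_assoc, (hCW₀ c hc m hm).eq, mul_assoc]
      exact Submodule.mul_mem_mul hm (C.mul_mem hc hc')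
    | add y _ z _ hy hz => rw [mul_add]; exact add_mem hy hz
  have huW : ∀ w ∈ W, u * w ∈ W := by
    induction hu using Algebra.adjoin_induction with
    | mem r hr =>
      rcases hr with (rfl | rfl | rfl) | hr
      · intro w hw
        rw [add_mul, mul_assoc]
        exact add_mem (hWJ _ (hWh _ hw)) (hWJ _ hw)
      · exact hWd
      · exact hWJ
      · exact hCW r hr
    | algebraMap a => intro w hw; rw [← Algebra.smul_def]; exact W.smul_mem a hw
    | add y z _ _ hy hz => intro w hw; rw [add_mul]; exact add_mem (hy w hw) (hz w hw)
    | mul y z _ _ hy hz => intro w hw; rw [mul_assoc]; exact hy _ (hz w hw)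
  have hu1 : u ∈ W := by simpa using huW 1 hone
  let Φ : ((ℤ × ℕ) ⊕ (ℕ × ℕ) →₀ Subalgebra.toSubmodule C) →ₗ[K] R :=
    Finsupp.lsum K fun i => LinearMap.mulLeft K (stdBasis K d J h i) ∘ₗ
      (Subalgebra.toSubmodule C).subtype
  have hΦ : W ≤ LinearMap.range Φ := by
    rw [hW, Submodule.mul_le]
    intro m hm c hc
    induction hm using Submodule.span_induction with
    | mem w hw =>
      obtain ⟨i, rfl⟩ := hw
      exact ⟨Finsupp.single i ⟨c, hc⟩, by simp [Φ]⟩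
    | zero => simp
    | add y z _ _ hy hz => rw [add_mul]; exact add_mem hy hz
    | smul a y _ hy => rw [smul_mul_assoc]; exact Submodule.smul_mem _ _ hy
  obtain ⟨f, hf⟩ := hΦ hu1
  -- The finite support is enlarged to a box; the added coefficients are zero.
  have hsub : ∃ (s : Finset ℤ) (A B : ℕ), f.support ⊆
      (s ×ˢ Finset.range A).disjSum (Finset.range B ×ˢ Finset.range B) := by
    refine ⟨f.support.toLeft.image Prod.fst, f.support.toLeft.sup Prod.snd + 1,
      f.support.toRight.sup Prod.fst + f.support.toRight.sup Prod.snd + 1, ?_⟩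
    rintro (⟨k, j⟩ | ⟨s, t⟩) hi
    · rw [Finset.inl_mem_disjSum, Finset.mem_product, Finset.mem_image, Finset.mem_range]
      have hi' := Finset.mem_toLeft.2 hi
      have := Finset.le_sup (f := Prod.snd) hi'
      exact ⟨⟨_, hi', rfl⟩, Nat.lt_succ_of_le this⟩
    · rw [Finset.inr_mem_disjSum, Finset.mem_product, Finset.mem_range, Finset.mem_range]
      have hi' := Finset.mem_toRight.2 hi
      have h1 := Finset.le_sup (f := Prod.fst) hi'
      have h2 := Finset.le_sup (f := Prod.snd) hi'
      simp only at h1 h2 ⊢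
      omega
  obtain ⟨s, A, B, hs⟩ := hsub
  refine ⟨s, A, B, fun i => f (.inl i), fun i => f (.inr i), fun i => (f _).2, fun i => (f _).2, ?_⟩
  rw [← hf, Finsupp.lsum_apply, Finsupp.sum_of_support_subset f hs _ (by simp),
    Finset.sum_disjSum, Finset.sum_product]
  rfl

end IsTriple
end
end IntDiff
end

noncomputable section

namespace IntDiff
open MvPolynomial

/-! ## The operators on monomials -/

section

variable {K : Type*} [Field K] {n : ℕ}

theorem mulX_monomial (i : Fin n) (α : Fin n →₀ ℕ) :
    mulX K i (monomial α 1) = monomial (α + Finsupp.single i 1) 1 := by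
  rw [mulX, LinearMap.mulLeft_apply, mul_comm, X, monomial_mul, one_mul]

theorem partialD_monomial (i : Fin n) (α : Fin n →₀ ℕ) :
    partialD K i (monomial α 1) = (α i : K) • monomial (α - Finsupp.single i 1) 1 := by
  rw [partialD, Derivation.coeFn_coe, pderiv_monomial, smul_monomial, one_mul, smul_eq_mul, mul_one]

theorem integ_monomial (i : Fin n) (α : Fin n →₀ ℕ) :
    integ K i (monomial α 1) = ((α i : K) + 1)⁻¹ • monomial (α + Finsupp.single i 1) 1 := by
  have := (basisMonomials (Fin n) K).constr_basis K
    (fun α => monomial (α + Finsupp.single i 1) (((α i : K) + 1)⁻¹)) α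
  rw [coe_basisMonomials] at this
  rw [integ, this, smul_monomial, smul_eq_mul, mul_one]

theorem algebraI_ext {u v : algebraI K n}
    (h : ∀ α, u.1 (monomial α 1) = v.1 (monomial α 1)) : u = v := by
  refine Subtype.ext ((basisMonomials (Fin n) K).ext fun α => ?_)
  rw [coe_basisMonomials]
  exact h α

theorem x_monomial (i : Fin n) (α : Fin n →₀ ℕ) :
    (x K i).1 (monomial α 1) = monomial (α + Finsupp.single i 1) 1 := mulX_monomial i α

theorem del_monomial (i : Fin n) (α : Fin n →₀ ℕ) :
    (del K i).1 (monomial α 1) = (α i : K) • monomial (α - Finsupp.single i 1) 1 :=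
  partialD_monomial i α

theorem int_monomial (i : Fin n) (α : Fin n →₀ ℕ) :
    (int K i).1 (monomial α 1) = ((α i : K) + 1)⁻¹ • monomial (α + Finsupp.single i 1) 1 :=
  integ_monomial i α

/-- The Euler operator `x_i ∂_i`. -/
def euler (K : Type*) [Field K] {n : ℕ} (i : Fin n) : algebraI K n := x K i * del K i

theorem mul_apply' (u v : algebraI K n) (p : MvPolynomial (Fin n) K) :
    (u * v).1 p = u.1 (v.1 p) := rfl

theorem add_apply' (u v : algebraI K n) (p : MvPolynomial (Fin n) K) :
    (u + v).1 p = u.1 p + v.1 p := rfl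

theorem sub_apply' (u v : algebraI K n) (p : MvPolynomial (Fin n) K) :
    (u - v).1 p = u.1 p - v.1 p := rfl

theorem one_apply' (p : MvPolynomial (Fin n) K) : (1 : algebraI K n).1 p = p := rfl

theorem euler_monomial (i : Fin n) (α : Fin n →₀ ℕ) :
    (euler K i).1 (monomial α 1) = (α i : K) • monomial α 1 := by
  rw [euler, mul_apply', del_monomial, map_smul, x_monomial]
  by_cases h : α i = 0
  · simp [h]
  · rw [tsub_add_cancel_of_le]
    rw [Finsupp.single_le_iff]; omega

theorem del_int_monomial [CharZero K] (i : Fin n) (α : Fin n →₀ ℕ) :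
    (del K i).1 ((int K i).1 (monomial α 1)) = monomial α 1 := by
  rw [int_monomial, map_smul, del_monomial, smul_smul, add_tsub_cancel_right]
  have : (α i : K) + 1 ≠ 0 := Nat.cast_add_one_ne_zero _
  simp [this]

theorem int_del_monomial [CharZero K] (i : Fin n) (α : Fin n →₀ ℕ) :
    (int K i).1 ((del K i).1 (monomial α 1)) = if α i = 0 then 0 else monomial α 1 := by
  rw [del_monomial, map_smul, int_monomial, smul_smul]
  split_ifs with h
  · simp [h]
  · have h1 : Finsupp.single i 1 ≤ α := by rw [Finsupp.single_le_iff]; omega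
    rw [tsub_add_cancel_of_le h1]
    have h2 : (((α - Finsupp.single i 1 : Fin n →₀ ℕ) i : ℕ) : K) + 1 = α i := by
      rw [Finsupp.tsub_apply, Finsupp.single_eq_same]
      exact_mod_cast Nat.sub_add_cancel (Nat.one_le_iff_ne_zero.2 h)
    rw [h2, mul_inv_cancel₀ (by exact_mod_cast h), one_smul]

theorem isTriple [CharZero K] (i : Fin n) : IsTriple (del K i) (int K i) (euler K i) where
  d_mul_J := algebraI_ext fun α => by rw [mul_apply', del_int_monomial, one_apply']
  d_mul_h := algebraI_ext fun α => by
    rw [add_apply', mul_apply', mul_apply', euler_monomial, map_smul, del_monomial, map_smul,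
      euler_monomial]
    by_cases h : α i = 0
    · simp [h]
    · obtain ⟨m, hm⟩ := Nat.exists_eq_succ_of_ne_zero h
      rw [Finsupp.tsub_apply, Finsupp.single_eq_same, hm, Nat.succ_eq_add_one, Nat.add_sub_cancel]
      push_cast
      module
  h_mul_J := algebraI_ext fun α => by
    rw [add_apply', mul_apply', mul_apply', euler_monomial, map_smul, int_monomial, map_smul,
      euler_monomial]
    simp only [Finsupp.add_apply, Finsupp.single_eq_same]
    push_cast
    module
  h_mul_proj := algebraI_ext fun α => by
    rw [mul_apply', sub_apply', one_apply', mul_apply', int_del_monomial]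
    split_ifs with h
    · rw [sub_zero, euler_monomial, h]; simp
    · rw [sub_self]; simp

/-- This explains the generator `J * h + J` in `exists_eq_sum`: modulo it, `x_i` is expressed by the
triple alone. -/
theorem x_eq [CharZero K] (i : Fin n) : x K i = int K i * euler K i + int K i :=
  algebraI_ext fun α => by
    rw [add_apply', mul_apply', euler_monomial, map_smul, int_monomial, x_monomial, smul_smul,
      ← add_smul, ← add_one_mul, mul_inv_cancel₀ (Nat.cast_add_one_ne_zero _), one_smul]

/-- The generators in the `i`-th variable. -/
def gens (K : Type*) [Field K] {n : ℕ} (i : Fin n) : Set (algebraI K n) :=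
  {x K i, del K i, int K i}

theorem commute_gens {i j : Fin n} (hij : i ≠ j) {a b : algebraI K n} (ha : a ∈ gens K i)
    (hb : b ∈ gens K j) : Commute a b := by
  have hji := hij.symm
  -- Subtraction of exponents is truncated, so raising and lowering can be interchanged here because
  -- they act on different variables.
  have e1 : ∀ α : Fin n →₀ ℕ, ∀ i j : Fin n, i ≠ j → α + Finsupp.single i 1 - Finsupp.single j 1 =
      α - Finsupp.single j 1 + Finsupp.single i 1 := by
    intro α i j hij
    ext k
    simp only [Finsupp.add_apply, Finsupp.tsub_apply, Finsupp.single_apply]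
    split_ifs <;> omega
  rcases ha with rfl | rfl | rfl <;> rcases hb with rfl | rfl | rfl <;>
    refine algebraI_ext fun α => ?_ <;>
    simp only [mul_apply', x_monomial, del_monomial, int_monomial, map_smul, Finsupp.add_apply,
      Finsupp.tsub_apply, Finsupp.single_apply, hij, hji, if_false, add_zero, tsub_zero, smul_smul,
      e1 α i j hij, e1 α j i hji, add_right_comm α (Finsupp.single i 1),
      tsub_right_comm (a := α) (b := Finsupp.single i 1)] <;>
    first | rfl | rw [mul_comm]

/-- The subalgebra generated by the variables in `S`. -/
def subAlg (K : Type*) [Field K] {n : ℕ} (S : Finset (Fin n)) : Subalgebra K (algebraI K n) :=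
  Algebra.adjoin K (⋃ i ∈ S, gens K i)

theorem matUnit_mem {R : Type*} [Ring R] [Algebra K R] (S : Subalgebra K R) {d J : R}
    (hd : d ∈ S) (hJ : J ∈ S) (s t : ℕ) : matUnit d J s t ∈ S :=
  sub_mem (mul_mem (pow_mem hJ _) (pow_mem hd _)) (mul_mem (pow_mem hJ _) (pow_mem hd _))

theorem commute_of_mem_adjoin {R : Type*} [Semiring R] [Algebra K R] {s t : Set R}
    (h : ∀ a ∈ s, ∀ b ∈ t, Commute a b) {a b : R} (ha : a ∈ Algebra.adjoin K s)
    (hb : b ∈ Algebra.adjoin K t) : Commute a b := by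
  refine Algebra.commute_of_mem_adjoin_of_forall_mem_commute hb fun b hb => ?_
  exact (Algebra.commute_of_mem_adjoin_of_forall_mem_commute ha fun a ha => (h a ha b hb).symm).symm

theorem subAlg_univ : subAlg K (Finset.univ : Finset (Fin n)) = ⊤ := by
  have h := Algebra.adjoin_adjoin_coe_preimage (R := K)
    (s := Set.range (mulX K (n := n)) ∪ Set.range (partialD K) ∪ Set.range (integ K))
  refine top_le_iff.1 (h.ge.trans (Algebra.adjoin_mono ?_))
  rintro u ((⟨i, hi⟩ | ⟨i, hi⟩) | ⟨i, hi⟩) <;>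
    refine Set.mem_biUnion (Finset.mem_univ i) ?_
  · exact Or.inl (Subtype.ext hi.symm)
  · exact Or.inr (Or.inl (Subtype.ext hi.symm))
  · exact Or.inr (Or.inr (Subtype.ext hi.symm))

/-! ## Products of projections -/

theorem e_eq_matUnit (i : Fin n) (s t : ℕ) : e K i s t = matUnit (del K i) (int K i) s t := rfl

theorem e_zero_monomial [CharZero K] (i : Fin n) (α : Fin n →₀ ℕ) :
    (e K i 0 0).1 (monomial α 1) = if α i = 0 then monomial α 1 else 0 := by
  rw [e_eq_matUnit, matUnit_eq, pow_zero, pow_zero, one_mul, mul_one, sub_apply', one_apply',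
    mul_apply', int_del_monomial]
  split_ifs <;> simp

/-- The product of the projections `e_{00}(i)`, `i ∈ T`. -/
def projProd (K : Type*) [Field K] {n : ℕ} (T : Finset (Fin n)) : algebraI K n :=
  (List.ofFn fun i => if i ∈ T then e K i 0 0 else 1).prod

theorem projProd_monomial [CharZero K] (T : Finset (Fin n)) (α : Fin n →₀ ℕ) :
    (projProd K T).1 (monomial α 1) = if ∀ i ∈ T, α i = 0 then monomial α 1 else 0 := by
  -- Arbitrary lists of variables allow induction on the factors.
  have key : ∀ l : List (Fin n),
      ((l.map fun i => if i ∈ T then e K i 0 0 else 1).prod).1 (monomial α 1) =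
        if ∀ i ∈ l, i ∈ T → α i = 0 then monomial α 1 else 0 := by
    intro l
    induction l with
    | nil => simp
    | cons a l ih =>
      rw [List.map_cons, List.prod_cons, mul_apply', ih]
      by_cases hl : ∀ i ∈ l, i ∈ T → α i = 0
      · rw [if_pos hl]
        by_cases ha : a ∈ T
        · rw [if_pos ha, e_zero_monomial]
          have : (∀ i ∈ a :: l, i ∈ T → α i = 0) ↔ α a = 0 :=
            ⟨fun h => h a (by simp) ha, fun h i hi hT => by
              rcases List.mem_cons.1 hi with rfl | hi
              exacts [h, hl i hi hT]⟩
          simp only [this]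
        · rw [if_neg ha, one_apply']
          simp [ha]
          tauto
      · rw [if_neg hl, map_zero, if_neg]
        intro h
        exact hl fun i hi => h i (List.mem_cons_of_mem _ hi)
  rw [projProd, List.ofFn_eq_map, key]
  simp

theorem projProd_empty [CharZero K] : projProd K (∅ : Finset (Fin n)) = 1 :=
  algebraI_ext fun α => by rw [projProd_monomial]; simp

theorem projProd_singleton [CharZero K] (i : Fin n) : projProd K {i} = e K i 0 0 :=
  algebraI_ext fun α => by rw [projProd_monomial, e_zero_monomial]; simp

theorem projProd_mul [CharZero K] (S T : Finset (Fin n)) :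
    projProd K S * projProd K T = projProd K (S ∪ T) :=
  algebraI_ext fun α => by
    rw [mul_apply', projProd_monomial, projProd_monomial]
    by_cases hT : ∀ i ∈ T, α i = 0
    · rw [if_pos hT, projProd_monomial]
      refine if_congr ?_ rfl rfl
      simp only [Finset.mem_union]
      exact ⟨fun h i hi => hi.elim (h i) (hT i), fun h i hi => h i (Or.inl hi)⟩
    · rw [if_neg hT, map_zero, if_neg]
      exact fun h => hT fun i hi => h i (Finset.mem_union_right _ hi)

theorem euler_mem_adjoin (i : Fin n) : euler K i ∈ Algebra.adjoin K (gens K i) :=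
  mul_mem (Algebra.subset_adjoin (Or.inl rfl)) (Algebra.subset_adjoin (Or.inr (Or.inl rfl)))

theorem del_mem_adjoin (i : Fin n) : del K i ∈ Algebra.adjoin K (gens K i) :=
  Algebra.subset_adjoin (Or.inr (Or.inl rfl))

theorem int_mem_adjoin (i : Fin n) : int K i ∈ Algebra.adjoin K (gens K i) :=
  Algebra.subset_adjoin (Or.inr (Or.inr rfl))

theorem e_mem_adjoin (i : Fin n) (s t : ℕ) : e K i s t ∈ Algebra.adjoin K (gens K i) :=
  matUnit_mem (R := algebraI K n) _ (del_mem_adjoin i) (int_mem_adjoin i) s t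

theorem commute_of_mem_adjoin_gens {i j : Fin n} (hij : i ≠ j) {a b : algebraI K n}
    (ha : a ∈ Algebra.adjoin K (gens K i)) (hb : b ∈ Algebra.adjoin K (gens K j)) :
    Commute a b :=
  commute_of_mem_adjoin (K := K) (R := algebraI K n) (s := gens K i) (t := gens K j)
    (fun _ ha _ hb => commute_gens hij ha hb) ha hb

theorem commute_projProd {k : Fin n} {T : Finset (Fin n)} (hk : k ∉ T) {a : algebraI K n}
    (ha : a ∈ Algebra.adjoin K (gens K k)) : Commute (projProd K T) a := by
  rw [projProd]
  refine Commute.list_prod_left _ _ fun y hy => ?_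
  obtain ⟨i, rfl⟩ := (List.mem_ofFn' _ _).1 hy
  simp only
  split_ifs with hi
  · exact commute_of_mem_adjoin_gens (by rintro rfl; exact hk hi) (e_mem_adjoin i 0 0) ha
  · exact Commute.one_left _

/-! ## Generation of ideals by products of projections -/

theorem commute_of_mem_subAlg {S : Finset (Fin n)} {k : Fin n} (hk : k ∉ S) {c a : algebraI K n}
    (hc : c ∈ subAlg K S) (ha : a ∈ Algebra.adjoin K (gens K k)) : Commute c a := by
  refine commute_of_mem_adjoin (K := K) (R := algebraI K n) (s := ⋃ i ∈ S, gens K i)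
    (t := gens K k) (fun a ha b hb => ?_) hc ha
  simp only [Set.mem_iUnion] at ha
  obtain ⟨i, hi, ha⟩ := ha
  exact commute_gens (by rintro rfl; exact hk hi) ha hb

theorem smul_mem_ideal {R : Type*} [Ring R] [Algebra K R] (a : TwoSidedIdeal R) (r : K) {u : R}
    (hu : u ∈ a) : r • u ∈ a := by
  rw [Algebra.smul_def]; exact a.mul_mem_left _ _ hu

/-- The elements whose product with `g` lies in a given ideal. -/
def colon {R : Type*} [Ring R] [Algebra K R] (g : R) (a : TwoSidedIdeal R) : Submodule K R where
  carrier := {c | g * c ∈ a}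
  zero_mem' := by simp [a.zero_mem]
  add_mem' := fun {y z} hy hz => by
    rw [Set.mem_ofPred_eq, mul_add]; exact a.add_mem hy hz
  smul_mem' := fun r y hy => by
    rw [Set.mem_ofPred_eq, mul_smul_comm]; exact smul_mem_ideal a r hy

/-- `S` holds the variables still occurring in `c`, and `T` those already replaced by projections.
Removing `k` from `S` expands `c` in the `k`-th variable: coefficients of the first kind keep `T`,
those of matrix units gain `e_{00}(k)` and pass to `insert k T`. With `S` empty, `c` is a scalar. -/
theorem projProd_mul_mem [CharZero K] (a L : TwoSidedIdeal (algebraI K n))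
    (hL : ∀ T, projProd K T ∈ a → projProd K T ∈ L) (S : Finset (Fin n)) :
    ∀ T : Finset (Fin n), Disjoint S T → ∀ c ∈ subAlg K S, projProd K T * c ∈ a →
      projProd K T * c ∈ L := by
  induction S using Finset.induction_on with
  | empty =>
    intro T _ c hc h
    rw [subAlg] at hc
    simp only [Finset.notMem_empty, Set.iUnion_of_empty, Set.iUnion_empty, Algebra.adjoin_empty]
      at hc
    obtain ⟨r, rfl⟩ := Algebra.mem_bot.1 hc
    rw [← Algebra.commutes, ← Algebra.smul_def] at h ⊢
    rcases eq_or_ne r 0 with rfl | hr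
    · rw [zero_smul]; exact L.zero_mem
    · refine smul_mem_ideal L r (hL T ?_)
      have := smul_mem_ideal a r⁻¹ h
      rwa [smul_smul, inv_mul_cancel₀ hr, one_smul] at this
  | insert k S hk ih =>
    intro T hT c hc h
    rw [Finset.disjoint_insert_left] at hT
    obtain ⟨hkT, hST⟩ := hT
    have hcomm : ∀ r ∈ Algebra.adjoin K (gens K k), Commute (projProd K T) r :=
      fun r hr => commute_projProd hkT hr
    have hCd : ∀ c ∈ subAlg K S, Commute c (del K k) :=
      fun c hc => commute_of_mem_subAlg hk hc (del_mem_adjoin k)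
    have hCJ : ∀ c ∈ subAlg K S, Commute c (int K k) :=
      fun c hc => commute_of_mem_subAlg hk hc (int_mem_adjoin k)
    have hCh : ∀ c ∈ subAlg K S, Commute c (euler K k) :=
      fun c hc => commute_of_mem_subAlg hk hc (euler_mem_adjoin k)
    have hc' : c ∈ Algebra.adjoin K ({int K k * euler K k + int K k, del K k, int K k} ∪
        (subAlg K S : Set (algebraI K n))) := by
      refine Algebra.adjoin_mono ?_ hc
      rw [← x_eq]
      intro y hy
      simp only [Set.mem_iUnion] at hy
      obtain ⟨i, hi, hy⟩ := hy
      rcases Finset.mem_insert.1 hi with rfl | hi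
      · exact Or.inl hy
      · exact Or.inr (Algebra.subset_adjoin (Set.mem_biUnion hi hy))
    obtain ⟨s, A, B, f, f', hf, hf', rfl⟩ :=
      (isTriple k).exists_eq_sum (subAlg K S) hCd hCJ hCh hc'
    -- Left stability needs `k ∉ T`, so that `projProd K T` commutes with the `k`-th variable.
    have hstab : IsStable (colon (K := K) (projProd K T) a) (del K k) (int K k) (euler K k) := by
      have hl : ∀ r ∈ Algebra.adjoin K (gens K k), ∀ v ∈ colon (K := K) (projProd K T) a,
          r * v ∈ colon (K := K) (projProd K T) a := by
        intro r hr v hv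
        change _ * (r * v) ∈ a
        rw [← mul_assoc, (hcomm r hr).eq, mul_assoc]
        exact a.mul_mem_left _ _ hv
      have hr : ∀ r, ∀ v ∈ colon (K := K) (projProd K T) a,
          v * r ∈ colon (K := K) (projProd K T) a := by
        intro r v hv
        change _ * (v * r) ∈ a
        rw [← mul_assoc]
        exact a.mul_mem_right _ _ hv
      exact ⟨hl _ (del_mem_adjoin k), hl _ (int_mem_adjoin k), hl _ (euler_mem_adjoin k),
        hr _, hr _, hr _⟩
    obtain ⟨h1, h2⟩ := (isTriple k).mem_of_sum_mem hstab s A B f f' (fun i => hCJ _ (hf i))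
      (fun i => hCh _ (hf i)) (fun i => hCJ _ (hf' i)) (fun i => hCd _ (hf' i)) h
    rw [mul_add, Finset.mul_sum, Finset.mul_sum]
    have hb : ∀ i, stdBasis K (del K k) (int K k) (euler K k) i * projProd K T =
        projProd K T * stdBasis K (del K k) (int K k) (euler K k) i := fun i =>
      (commute_stdBasis (hcomm _ (del_mem_adjoin k)) (hcomm _ (int_mem_adjoin k))
        (hcomm _ (euler_mem_adjoin k)) i).eq.symm
    refine L.add_mem (sum_mem fun i hi => ?_) (sum_mem fun i hi => ?_)
    · rw [Finset.mul_sum]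
      refine sum_mem fun j hj => ?_
      rw [← mul_assoc, ← hb, mul_assoc]
      exact L.mul_mem_left _ _ (ih T hST _ (hf _) (h1 i hi j (Finset.mem_range.1 hj)))
    · have h3 : projProd K (insert k T) * f' i ∈ L := by
        refine ih _ (Finset.disjoint_insert_right.2 ⟨hk, hST⟩) _ (hf' i) ?_
        rw [Finset.insert_eq, Finset.union_comm, ← projProd_mul, projProd_singleton, mul_assoc]
        exact h2 i hi
      obtain ⟨p, q⟩ := i
      -- `e_{pq}(k)` is recovered from `e_{00}(k)` as `∫_k ^ p * e_{00}(k) * ∂_k ^ q`.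
      have h4 := L.mul_mem_right _ (del K k ^ q) (L.mul_mem_left (int K k ^ p) _ h3)
      convert h4 using 1
      rw [← mul_assoc, ← hb, Finset.insert_eq, ← projProd_mul, projProd_singleton, e_eq_matUnit]
      simp only [stdBasis, matUnit_eq, pow_zero, one_mul, mul_one]
      have e1 : Commute (f' (p, q)) (del K k ^ q) := (hCd _ (hf' _)).pow_right q
      have e2 : Commute (projProd K T) (del K k ^ q) := (hcomm _ (del_mem_adjoin k)).pow_right q
      simp only [mul_assoc]
      rw [e1.eq, ← mul_assoc (projProd K T), e2.eq, mul_assoc]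

/-- Every ideal is generated by the products of projections that it contains. -/
theorem ideal_le_of_projProd_mem [CharZero K] {a L : TwoSidedIdeal (algebraI K n)}
    (hL : ∀ T, projProd K T ∈ a → projProd K T ∈ L) : a ≤ L := by
  intro c hc
  have := projProd_mul_mem a L hL Finset.univ ∅ (Finset.disjoint_empty_right _) c
    (by rw [subAlg_univ]; trivial)
  rw [projProd_empty, one_mul] at this
  exact this hc

end
end IntDiff
end

noncomputable section

namespace IntDiff
open MvPolynomial

section

variable {K : Type*} [Field K] {n : ℕ}

/-! ## The subspaces `I_f` are ideals -/

/-- The element `r` passes the factors before position `i` and is absorbed there; this shows that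
pure tensors are stable under generators. -/
theorem prod_ofFn_update_mul {M : Type*} [Monoid M] {m : ℕ} (a : Fin m → M) (i : Fin m) (r : M)
    (h : ∀ j < i, Commute r (a j)) :
    r * (List.ofFn a).prod = (List.ofFn (Function.update a i (r * a i))).prod := by
  induction m with
  | zero => exact i.elim0
  | succ m ih =>
    rw [List.ofFn_succ, List.ofFn_succ, List.prod_cons, List.prod_cons]
    cases i using Fin.cases with
    | zero => simp [Function.update_self, mul_assoc, Fin.succ_ne_zero]
    | succ i =>
      have e := Function.update_comp_eq_of_injective a (Fin.succ_injective m) i (r * a i.succ)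
      have := ih (fun j => a j.succ) i fun j hj => h _ (Fin.succ_lt_succ_iff.2 hj)
      rw [Function.update_of_ne (Fin.succ_ne_zero i).symm, ← mul_assoc,
        (h 0 (Fin.succ_pos i)).eq, mul_assoc, this]
      congr 3
      exact e.symm

theorem prod_ofFn_mul_update {M : Type*} [Monoid M] {m : ℕ} (a : Fin m → M) (i : Fin m) (r : M)
    (h : ∀ j > i, Commute r (a j)) :
    (List.ofFn a).prod * r = (List.ofFn (Function.update a i (a i * r))).prod := by
  induction m with
  | zero => exact i.elim0
  | succ m ih =>
    rw [List.ofFn_succ, List.ofFn_succ, List.prod_cons, List.prod_cons]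
    cases i using Fin.cases with
    | zero =>
      have : Commute r (List.ofFn fun j => a (Fin.succ j)).prod := by
        refine Commute.list_prod_right _ _ fun y hy => ?_
        obtain ⟨j, rfl⟩ := (List.mem_ofFn' _ _).1 hy
        exact h _ (Fin.succ_pos j)
      rw [mul_assoc, ← this.eq]
      simp [Function.update_self, mul_assoc, Fin.succ_ne_zero]
    | succ i =>
      have e := Function.update_comp_eq_of_injective a (Fin.succ_injective m) i (a i.succ * r)
      have := ih (fun j => a j.succ) i fun j hj => h _ (Fin.succ_lt_succ_iff.2 hj)
      rw [Function.update_of_ne (Fin.succ_ne_zero i).symm, mul_assoc, this]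
      congr 3
      exact e.symm

theorem e_mem_F (i : Fin n) (s t : ℕ) : e K i s t ∈ F K i := Submodule.subset_span ⟨(s, t), rfl⟩

theorem gens_mul_F [CharZero K] {i : Fin n} {r : algebraI K n} (hr : r ∈ gens K i)
    {u : algebraI K n} (hu : u ∈ F K i) : r * u ∈ F K i := by
  have T := isTriple (K := K) i
  induction hu using Submodule.span_induction with
  | mem w hw =>
    obtain ⟨⟨s, t⟩, rfl⟩ := hw
    have hJ : int K i * e K i s t = e K i (s + 1) t := IsTriple.J_mul_matUnit (R := algebraI K n) s t
    rcases hr with rfl | rfl | rfl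
    · have hh : euler K i * e K i s t = s * e K i s t := T.h_mul_matUnit s t
      rw [x_eq, add_mul, mul_assoc]
      simp only
      rw [hh, ← nsmul_eq_mul, mul_smul_comm, hJ]
      exact add_mem (Submodule.smul_of_tower_mem _ s (e_mem_F _ _ _)) (e_mem_F _ _ _)
    · cases s with
      | zero =>
        have hd : del K i * e K i 0 t = 0 := T.d_mul_matUnit_zero t
        simp only [hd]
        exact zero_mem _
      | succ s =>
        have hd : del K i * e K i (s + 1) t = e K i s t := T.d_mul_matUnit_succ s t
        simp only [hd]
        exact e_mem_F _ _ _
    · simp only [hJ]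
      exact e_mem_F _ _ _
  | zero => rw [mul_zero]; exact zero_mem _
  | add y z _ _ hy hz => rw [mul_add]; exact add_mem hy hz
  | smul a y _ hy => rw [mul_smul_comm]; exact Submodule.smul_mem _ _ hy

theorem F_mul_gens [CharZero K] {i : Fin n} {r : algebraI K n} (hr : r ∈ gens K i)
    {u : algebraI K n} (hu : u ∈ F K i) : u * r ∈ F K i := by
  have T := isTriple (K := K) i
  induction hu using Submodule.span_induction with
  | mem w hw =>
    obtain ⟨⟨s, t⟩, rfl⟩ := hw
    have hJ : e K i s t * int K i ∈ F K i := by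
      cases t with
      | zero =>
        have hd : e K i s 0 * int K i = 0 := T.matUnit_zero_mul_J s
        rw [hd]
        exact zero_mem _
      | succ t =>
        have hd : e K i s (t + 1) * int K i = e K i s t := T.matUnit_succ_mul_J s t
        rw [hd]
        exact e_mem_F _ _ _
    have hJh : e K i s t * int K i * euler K i ∈ F K i := by
      cases t with
      | zero =>
        have hd : e K i s 0 * int K i = 0 := T.matUnit_zero_mul_J s
        rw [hd, zero_mul]
        exact zero_mem _
      | succ t =>
        have hd : e K i s (t + 1) * int K i = e K i s t := T.matUnit_succ_mul_J s t
        have hh : e K i s t * euler K i = t * e K i s t := T.matUnit_mul_h s t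
        rw [hd, hh, ← nsmul_eq_mul]
        exact Submodule.smul_of_tower_mem _ t (e_mem_F _ _ _)
    rcases hr with rfl | rfl | rfl
    · rw [x_eq, mul_add, ← mul_assoc]
      exact add_mem hJh hJ
    · have hd : e K i s t * del K i = e K i s (t + 1) := IsTriple.matUnit_mul_d (R := algebraI K n) s t
      simp only [hd]
      exact e_mem_F _ _ _
    · exact hJ
  | zero => rw [zero_mul]; exact zero_mem _
  | add y z _ _ hy hz => rw [add_mul]; exact add_mem hy hz
  | smul a y _ hy => rw [smul_mul_assoc]; exact Submodule.smul_mem _ _ hy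

theorem component_le_adjoin (f : Fin n → Fin 2) (i : Fin n) {u : algebraI K n}
    (hu : u ∈ component K f i) : u ∈ Algebra.adjoin K (gens K i) := by
  rw [component] at hu
  split_ifs at hu with h
  · refine (Submodule.span_le (p := Subalgebra.toSubmodule (Algebra.adjoin K (gens K i)))).2 ?_ hu
    rintro _ ⟨⟨s, t⟩, rfl⟩
    exact e_mem_adjoin i s t
  · exact hu

theorem gens_mul_component [CharZero K] {f : Fin n → Fin 2} {i : Fin n} {r : algebraI K n}
    (hr : r ∈ gens K i) {u : algebraI K n} (hu : u ∈ component K f i) :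
    r * u ∈ component K f i := by
  rw [component] at hu ⊢
  split_ifs at hu ⊢ with h
  · exact gens_mul_F hr hu
  · exact (factor K i).mul_mem (Algebra.subset_adjoin hr) hu

theorem component_mul_gens [CharZero K] {f : Fin n → Fin 2} {i : Fin n} {r : algebraI K n}
    (hr : r ∈ gens K i) {u : algebraI K n} (hu : u ∈ component K f i) :
    u * r ∈ component K f i := by
  rw [component] at hu ⊢
  split_ifs at hu ⊢ with h
  · exact F_mul_gens hr hu
  · exact (factor K i).mul_mem hu (Algebra.subset_adjoin hr)

/-- An induction principle for the algebra of integro-differential operators. -/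
theorem algebraI_induction {P : algebraI K n → Prop}
    (hgens : ∀ i, ∀ r ∈ gens K i, P r) (hscalar : ∀ a : K, P (algebraMap K _ a))
    (hadd : ∀ y z, P y → P z → P (y + z)) (hmul : ∀ y z, P y → P z → P (y * z))
    (u : algebraI K n) : P u := by
  have hu : u ∈ subAlg K (Finset.univ : Finset (Fin n)) := by rw [subAlg_univ]; trivial
  rw [subAlg] at hu
  induction hu using Algebra.adjoin_induction with
  | mem r hr =>
    obtain ⟨i, _, hr⟩ := Set.mem_iUnion₂.1 hr
    exact hgens i r hr
  | algebraMap a => exact hscalar a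
  | add y z _ _ hy hz => exact hadd y z hy hz
  | mul y z _ _ hy hz => exact hmul y z hy hz

theorem update_mem_component {f : Fin n → Fin 2} {a : Fin n → algebraI K n}
    (ha : ∀ i, a i ∈ component K f i) (i : Fin n) {u : algebraI K n} (hu : u ∈ component K f i)
    (j : Fin n) : Function.update a i u j ∈ component K f j := by
  rcases eq_or_ne j i with rfl | hj
  · rwa [Function.update_self]
  · rw [Function.update_of_ne hj]; exact ha j

theorem mul_mem_tensorSubspace [CharZero K] (f : Fin n → Fin 2) (u : algebraI K n) :
    ∀ v ∈ tensorSubspace K f, u * v ∈ tensorSubspace K f := by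
  induction u using algebraI_induction with
  | hgens i r hr =>
    intro v hv
    induction hv using Submodule.span_induction with
    | mem v hv =>
      obtain ⟨a, ha, rfl⟩ := hv
      rw [prod_ofFn_update_mul a i r fun j hj => commute_of_mem_adjoin_gens hj.ne'
        (Algebra.subset_adjoin hr) (component_le_adjoin f j (ha j))]
      exact Submodule.subset_span
        ⟨_, update_mem_component ha i (gens_mul_component hr (ha i)), rfl⟩
    | zero => rw [mul_zero]; exact zero_mem _
    | add y z _ _ hy hz => rw [mul_add]; exact add_mem hy hz
    | smul a y _ hy => rw [mul_smul_comm]; exact Submodule.smul_mem _ _ hy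
  | hscalar a => intro v hv; rw [← Algebra.smul_def]; exact Submodule.smul_mem _ _ hv
  | hadd y z hy hz => intro v hv; rw [add_mul]; exact add_mem (hy v hv) (hz v hv)
  | hmul y z hy hz => intro v hv; rw [mul_assoc]; exact hy _ (hz v hv)

theorem tensorSubspace_mul_mem [CharZero K] (f : Fin n → Fin 2) (u : algebraI K n) :
    ∀ v ∈ tensorSubspace K f, v * u ∈ tensorSubspace K f := by
  induction u using algebraI_induction with
  | hgens i r hr =>
    intro v hv
    induction hv using Submodule.span_induction with
    | mem v hv =>
      obtain ⟨a, ha, rfl⟩ := hv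
      rw [prod_ofFn_mul_update a i r fun j hj => commute_of_mem_adjoin_gens hj.ne
        (Algebra.subset_adjoin hr) (component_le_adjoin f j (ha j))]
      exact Submodule.subset_span
        ⟨_, update_mem_component ha i (component_mul_gens hr (ha i)), rfl⟩
    | zero => rw [zero_mul]; exact zero_mem _
    | add y z _ _ hy hz => rw [add_mul]; exact add_mem hy hz
    | smul a y _ hy => rw [smul_mul_assoc]; exact Submodule.smul_mem _ _ hy
  | hscalar a =>
    intro v hv
    rw [← Algebra.commutes, ← Algebra.smul_def]
    exact Submodule.smul_mem _ _ hv
  | hadd y z hy hz => intro v hv; rw [mul_add]; exact add_mem (hy v hv) (hz v hv)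
  | hmul y z hy hz => intro v hv; rw [← mul_assoc]; exact hz _ (hy v hv)

/-- The linear span of the pure tensors is already stable under multiplication from both sides,
since each factor `F(i)` is stable under the generators of its variable. -/
theorem coe_idealI [CharZero K] (f : Fin n → Fin 2) :
    (idealI K f : Set (algebraI K n)) = tensorSubspace K f := by
  apply Set.Subset.antisymm
  · let J : TwoSidedIdeal (algebraI K n) := TwoSidedIdeal.mk' (tensorSubspace K f)
      (zero_mem _) (fun hx hy => add_mem hx hy)
      (fun {y} hy => by
        rw [← neg_one_smul K y]; exact Submodule.smul_mem _ _ hy)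
      (fun {u v} hv => mul_mem_tensorSubspace f u v hv)
      (fun {v u} hv => tensorSubspace_mul_mem f u v hv)
    have h : idealI K f ≤ J := by
      refine TwoSidedIdeal.span_le.2 fun z hz => ?_
      rw [SetLike.mem_coe, TwoSidedIdeal.mem_mk']
      exact Submodule.subset_span hz
    intro z hz
    have := h hz
    rwa [TwoSidedIdeal.mem_mk'] at this
  · intro z hz
    rw [SetLike.mem_coe] at hz ⊢
    rw [tensorSubspace] at hz
    induction hz using Submodule.span_induction with
    | mem z hz => exact TwoSidedIdeal.subset_span hz
    | zero => exact (idealI K f).zero_mem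
    | add y z _ _ hy hz => exact (idealI K f).add_mem hy hz
    | smul a y _ hy => exact smul_mem_ideal _ a hy

/-! ## The ideals of operators vanishing on monomials with large exponents -/

/-- The ideal of all operators that kill the monomials whose exponents at `S` are large. -/
def vanishing (K : Type*) [Field K] {n : ℕ} (S : Finset (Fin n)) :
    TwoSidedIdeal (algebraI K n) :=
  TwoSidedIdeal.mk' {v | ∃ N : ℕ, ∀ α : Fin n →₀ ℕ, (∀ i ∈ S, N ≤ α i) → v.1 (monomial α 1) = 0}
    ⟨0, fun _ _ => rfl⟩
    (fun {y z} ⟨N, hN⟩ ⟨M, hM⟩ => ⟨max N M, fun α hα => by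
      rw [add_apply', hN α fun i hi => (le_max_left _ _).trans (hα i hi),
        hM α fun i hi => (le_max_right _ _).trans (hα i hi), add_zero]⟩)
    (fun {y} ⟨N, hN⟩ => ⟨N, fun α hα => by
      have := hN α hα
      change (-y.1) _ = 0
      rw [LinearMap.neg_apply, this, neg_zero]⟩)
    (fun {y z} ⟨N, hN⟩ => ⟨N, fun α hα => by rw [mul_apply', hN α hα, map_zero]⟩)
    (by
      intro v u
      -- Right multiplication is the delicate case: `u` acts on the monomial before `v`, and a
      -- generator lowers an exponent by at most one.
      induction u using algebraI_induction generalizing v with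
      | hgens i r hr =>
        rintro ⟨N, hN⟩
        have hadd : ∀ α : Fin n →₀ ℕ, (∀ j ∈ S, N ≤ α j) →
            v.1 (monomial (α + Finsupp.single i 1) 1) = 0 := fun α hα =>
          hN _ fun j hj => (hα j hj).trans (by simp)
        rcases hr with rfl | rfl | rfl
        · exact ⟨N, fun α hα => by rw [mul_apply', x_monomial, hadd α hα]⟩
        · refine ⟨N + 1, fun α hα => ?_⟩
          rw [mul_apply', del_monomial, map_smul, hN, smul_zero]
          intro j hj
          have := hα j hj
          rw [Finsupp.tsub_apply, Finsupp.single_apply]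
          split_ifs <;> omega
        · exact ⟨N, fun α hα => by rw [mul_apply', int_monomial, map_smul, hadd α hα, smul_zero]⟩
      | hscalar a =>
        rintro ⟨N, hN⟩
        refine ⟨N, fun α hα => ?_⟩
        rw [← Algebra.commutes, ← Algebra.smul_def]
        change a • v.1 _ = 0
        rw [hN α hα, smul_zero]
      | hadd y z hy hz =>
        intro hv
        obtain ⟨N, hN⟩ := hy hv
        obtain ⟨M, hM⟩ := hz hv
        refine ⟨max N M, fun α hα => ?_⟩
        rw [mul_add, add_apply', hN α fun i hi => (le_max_left _ _).trans (hα i hi),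
          hM α fun i hi => (le_max_right _ _).trans (hα i hi), add_zero]
      | hmul y z hy hz =>
        intro hv
        rw [← mul_assoc]
        exact hz (hy hv))

theorem mem_vanishing {S : Finset (Fin n)} {v : algebraI K n} :
    v ∈ vanishing K S ↔
      ∃ N : ℕ, ∀ α : Fin n →₀ ℕ, (∀ i ∈ S, N ≤ α i) → v.1 (monomial α 1) = 0 := by
  rw [vanishing, TwoSidedIdeal.mem_mk']; rfl

theorem projProd_mem_vanishing [CharZero K] {S T : Finset (Fin n)} :
    projProd K T ∈ vanishing K S ↔ ∃ i ∈ S, i ∈ T := by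
  rw [mem_vanishing]
  constructor
  · rintro ⟨N, hN⟩
    by_contra! hST
    -- If `S` and `T` are disjoint, this monomial has large exponents on `S` but is fixed by the
    -- projection.
    have := hN (Finsupp.equivFunOnFinite.symm fun i => if i ∈ S then N else 0)
      (fun i hi => by simp [hi])
    rw [projProd_monomial, if_pos] at this
    · exact one_ne_zero (monomial_eq_zero.1 this)
    · intro i hi
      have : i ∉ S := fun h => hST i h hi
      simp [this]
  · rintro ⟨i, hS, hT⟩
    refine ⟨1, fun α hα => ?_⟩
    rw [projProd_monomial, if_neg]
    intro h
    have h1 := hα i hS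
    rw [h i hT] at h1
    omega

/-! ### Ideals as up-sets of sets of variables -/

theorem projProd_mem_mono [CharZero K] {a : TwoSidedIdeal (algebraI K n)} {S T : Finset (Fin n)}
    (hST : S ⊆ T) (hS : projProd K S ∈ a) : projProd K T ∈ a := by
  rw [← Finset.union_eq_right.2 hST, ← projProd_mul]
  exact a.mul_mem_right _ _ hS

theorem le_iff_projProd_mem [CharZero K] {a b : TwoSidedIdeal (algebraI K n)} :
    a ≤ b ↔ ∀ T, projProd K T ∈ a → projProd K T ∈ b :=
  ⟨fun h _ hT => h hT, ideal_le_of_projProd_mem⟩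

theorem ext_projProd [CharZero K] {a b : TwoSidedIdeal (algebraI K n)}
    (h : ∀ T, projProd K T ∈ a ↔ projProd K T ∈ b) : a = b :=
  le_antisymm (le_iff_projProd_mem.2 fun T => (h T).1) (le_iff_projProd_mem.2 fun T => (h T).2)

/-- `vanishing K Tᶜ` contains `projProd K S` exactly when `S ⊄ T`, while an ideal containing some
`projProd K S` with `S ⊆ T` contains `projProd K T`. -/
theorem le_vanishing_compl_iff [CharZero K] {a : TwoSidedIdeal (algebraI K n)}
    {T : Finset (Fin n)} : a ≤ vanishing K Tᶜ ↔ projProd K T ∉ a := by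
  rw [le_iff_projProd_mem]
  simp only [projProd_mem_vanishing, Finset.mem_compl]
  constructor
  · intro h hT
    obtain ⟨i, h1, h2⟩ := h T hT
    exact h1 h2
  · intro h S hS
    by_contra! hST
    exact h (projProd_mem_mono (fun i hi => by_contra fun h' => hST i h' hi) hS)

/-- The ideals omitting `projProd K T` are those below one fixed ideal, so a sum omits it as soon as
all summands do. -/
theorem projProd_mem_iSup [CharZero K] {ι : Sort*} {b : ι → TwoSidedIdeal (algebraI K n)}
    {T : Finset (Fin n)} : projProd K T ∈ ⨆ j, b j ↔ ∃ j, projProd K T ∈ b j := by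
  rw [← not_iff_not, ← le_vanishing_compl_iff, iSup_le_iff]
  simp only [le_vanishing_compl_iff, not_exists]

theorem projProd_mem_sup [CharZero K] {a b : TwoSidedIdeal (algebraI K n)}
    {T : Finset (Fin n)} : projProd K T ∈ a ⊔ b ↔ projProd K T ∈ a ∨ projProd K T ∈ b := by
  rw [← not_iff_not, ← le_vanishing_compl_iff, sup_le_iff, le_vanishing_compl_iff,
    le_vanishing_compl_iff, not_or]

theorem projProd_notMem_bot [CharZero K] (T : Finset (Fin n)) :
    projProd K T ∉ (⊥ : TwoSidedIdeal (algebraI K n)) :=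
  le_vanishing_compl_iff.1 bot_le

theorem eq_top_iff_projProd_mem [CharZero K] {a : TwoSidedIdeal (algebraI K n)} :
    a = ⊤ ↔ projProd K ∅ ∈ a := by
  rw [projProd_empty, TwoSidedIdeal.one_mem_iff]

/-! ## The ideals `I_f` -/

theorem list_prod_mem {R : Type*} [Ring R] (J : TwoSidedIdeal R) {l : List R} {y : R} (hy : y ∈ l)
    (hJ : y ∈ J) : l.prod ∈ J := by
  induction l with
  | nil => simp at hy
  | cons z l ih =>
    rw [List.prod_cons]
    rcases List.mem_cons.1 hy with rfl | h
    · exact J.mul_mem_right _ _ hJ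
    · exact J.mul_mem_left _ _ (ih h)

theorem mem_vanishing_of_mem_F [CharZero K] {S : Finset (Fin n)} {i : Fin n} (hi : i ∈ S)
    {u : algebraI K n} (hu : u ∈ F K i) : u ∈ vanishing K S := by
  induction hu using Submodule.span_induction with
  | mem u hu =>
    obtain ⟨⟨s, t⟩, rfl⟩ := hu
    have h : e K i s t = int K i ^ s * e K i 0 0 * del K i ^ t := by
      rw [e_eq_matUnit, e_eq_matUnit, matUnit_eq, matUnit_eq, pow_zero, pow_zero, one_mul, mul_one]
    simp only [h, ← projProd_singleton]
    exact TwoSidedIdeal.mul_mem_right _ _ _ (TwoSidedIdeal.mul_mem_left _ _ _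
      (projProd_mem_vanishing.2 ⟨i, hi, Finset.mem_singleton_self i⟩))
  | zero => exact TwoSidedIdeal.zero_mem _
  | add y z _ _ hy hz => exact TwoSidedIdeal.add_mem _ hy hz
  | smul a y _ hy => exact smul_mem_ideal _ a hy

theorem projProd_mem_idealI [CharZero K] {f : Fin n → Fin 2} {T : Finset (Fin n)} :
    projProd K T ∈ idealI K f ↔ ∀ i, f i = 0 → i ∈ T := by
  constructor
  · intro h i hi
    by_contra hT
    -- If `f i = 0` and `i ∉ T`, every pure tensor has a factor in `F(i)`, which lies in `vanishing
    -- K Tᶜ`.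
    refine le_vanishing_compl_iff.1 (TwoSidedIdeal.span_le.2 ?_) h
    rintro _ ⟨a, ha, rfl⟩
    refine list_prod_mem _ (List.mem_ofFn.2 ⟨i, rfl⟩)
      (mem_vanishing_of_mem_F (Finset.mem_compl.2 hT) ?_)
    have := ha i
    rwa [component, if_pos hi] at this
  · intro h
    refine projProd_mem_mono (S := Finset.univ.filter fun i => f i = 0)
      (fun i hi => h i (Finset.mem_filter.1 hi).2) (TwoSidedIdeal.subset_span ⟨_, fun i => ?_, rfl⟩)
    rw [component]
    by_cases hi : f i = 0
    · simp only [Finset.mem_filter, Finset.mem_univ, hi, true_and, if_true]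
      exact e_mem_F i 0 0
    · simp only [Finset.mem_filter, Finset.mem_univ, hi, true_and, if_false]
      exact (factor K i).one_mem

theorem projProd_mem_p [CharZero K] {i : Fin n} {T : Finset (Fin n)} :
    projProd K T ∈ p K i ↔ i ∈ T := by
  rw [p, projProd_mem_idealI]
  constructor
  · intro h; exact h i (by simp)
  · intro h j hj
    split_ifs at hj with h'
    · exact h' ▸ h
    · simp at hj

theorem projProd_mem_Fn [CharZero K] {T : Finset (Fin n)} :
    projProd K T ∈ Fn K n ↔ ∀ i, i ∈ T := by
  rw [Fn, projProd_mem_idealI]; simp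

theorem projProd_mem_pSum [CharZero K] {I T : Finset (Fin n)} :
    projProd K T ∈ pSum K I ↔ ∃ i ∈ I, i ∈ T := by
  simp only [pSum, projProd_mem_iSup, projProd_mem_p, exists_prop]

theorem projProd_mem_aMax [CharZero K] {T : Finset (Fin n)} :
    projProd K T ∈ aMax K n ↔ T.Nonempty := by
  simp only [aMax, projProd_mem_iSup, projProd_mem_p]; rfl

theorem pSum_eq_vanishing [CharZero K] (I : Finset (Fin n)) : pSum K I = vanishing K I :=
  ext_projProd fun T => by rw [projProd_mem_pSum, projProd_mem_vanishing]

/-! ## Products, primes -/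

theorem mul_eq_inf [CharZero K] (a b : TwoSidedIdeal (algebraI K n)) :
    RingIdeal.mul a b = a ⊓ b := by
  apply le_antisymm
  · rw [RingIdeal.mul_le]
    intro y hy z hz
    exact (TwoSidedIdeal.mem_inf _).2 ⟨a.mul_mem_right _ _ hy, b.mul_mem_left _ _ hz⟩
  · rw [le_iff_projProd_mem]
    intro T hT
    rw [← Finset.union_self T, ← projProd_mul]
    exact RingIdeal.mul_mem_mul ((TwoSidedIdeal.mem_inf _).1 hT).1 ((TwoSidedIdeal.mem_inf _).1 hT).2

theorem inf_sup_distrib [CharZero K] (a b c : TwoSidedIdeal (algebraI K n)) :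
    a ⊓ (b ⊔ c) = (a ⊓ b) ⊔ (a ⊓ c) :=
  ext_projProd fun T => by
    simp only [TwoSidedIdeal.mem_inf, projProd_mem_sup, and_or_left]

/-- `𝔭_I` is the largest ideal omitting `projProd K Iᶜ`; two ideals not below it both contain this
idempotent, hence so does their product. -/
theorem isPrime_pSum [CharZero K] (I : Finset (Fin n)) : RingIdeal.IsPrime (pSum K I) := by
  refine ⟨fun h => ?_, fun a b hab => ?_⟩
  · rw [eq_top_iff_projProd_mem, projProd_mem_pSum] at h
    simp at h
  · have hI : pSum K I = vanishing K Iᶜᶜ := by rw [compl_compl, pSum_eq_vanishing]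
    rw [hI] at hab ⊢
    rw [le_vanishing_compl_iff, le_vanishing_compl_iff, ← not_and_or, ← TwoSidedIdeal.mem_inf,
      ← mul_eq_inf]
    exact le_vanishing_compl_iff.1 hab

/-- `I` collects the `i` with `e_{00}(i) ∈ P`. Primality splits any `projProd K T` in `P` into its
one-variable factors, one of which must lie in `P`. -/
theorem eq_pSum_of_isPrime [CharZero K] {P : TwoSidedIdeal (algebraI K n)}
    (hP : RingIdeal.IsPrime P) : ∃ I : Finset (Fin n), pSum K I = P := by
  classical
  refine ⟨Finset.univ.filter fun i => projProd K {i} ∈ P, ext_projProd fun T => ?_⟩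
  rw [projProd_mem_pSum]
  simp only [Finset.mem_filter, Finset.mem_univ, true_and]
  constructor
  · rintro ⟨i, hi, hT⟩
    exact projProd_mem_mono (Finset.singleton_subset_iff.2 hT) hi
  · intro h
    by_contra! hT
    induction T using Finset.induction_on with
    | empty => exact hP.1 (eq_top_iff_projProd_mem.2 h)
    | insert k T hk ih =>
      have key : ∀ S S' : Finset (Fin n), projProd K (S ∪ S') ∈ P →
          projProd K S ∈ P ∨ projProd K S' ∈ P := by
        intro S S' hSS
        have := hP.2 (TwoSidedIdeal.span {projProd K S}) (TwoSidedIdeal.span {projProd K S'}) ?_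
        · exact this.imp (fun h => h (TwoSidedIdeal.subset_span rfl))
            (fun h => h (TwoSidedIdeal.subset_span rfl))
        · rw [mul_eq_inf, le_iff_projProd_mem]
          -- The ideal generated by `projProd K S` contains only idempotents indexed by supersets of
          -- `S`, so the intersection of two such ideals is controlled by the union of their index
          -- sets.
          have hs : ∀ S T : Finset (Fin n),
              projProd K T ∈ TwoSidedIdeal.span {projProd K S} → S ⊆ T := by
            intro S T h i hi
            by_contra hiT
            refine le_vanishing_compl_iff.1 (TwoSidedIdeal.span_le.2 ?_) h
            rw [Set.singleton_subset_iff]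
            exact projProd_mem_vanishing.2 ⟨i, Finset.mem_compl.2 hiT, hi⟩
          intro U hU
          rw [TwoSidedIdeal.mem_inf] at hU
          exact projProd_mem_mono (Finset.union_subset (hs _ _ hU.1) (hs _ _ hU.2)) hSS
      rw [Finset.insert_eq] at h
      rcases key _ _ h with h | h
      · exact hT k h (Finset.mem_insert_self k T)
      · exact ih h fun i hi hi' => hT i hi (Finset.mem_insert_of_mem hi')

theorem pSum_le_pSum_iff [CharZero K] {I J : Finset (Fin n)} : pSum K I ≤ pSum K J ↔ I ⊆ J := by
  constructor
  · intro h i hi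
    have := h (projProd_mem_pSum.2 ⟨i, hi, Finset.mem_singleton_self i⟩)
    obtain ⟨j, hj, hji⟩ := projProd_mem_pSum.1 this
    rwa [← Finset.mem_singleton.1 hji]
  · intro h
    exact biSup_mono fun i hi => h hi

/-- The order isomorphism between the subsets of the variables and the prime spectrum. -/
def specIso (K : Type*) [Field K] [CharZero K] (n : ℕ) :
    Finset (Fin n) ≃o RingIdeal.Spec (algebraI K n) where
  toEquiv := Equiv.ofBijective (fun I => ⟨pSum K I, isPrime_pSum I⟩)
    ⟨fun I J h => by
      have h' : pSum K I = pSum K J := congrArg Subtype.val h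
      exact Finset.Subset.antisymm (pSum_le_pSum_iff.1 h'.le) (pSum_le_pSum_iff.1 h'.ge),
    fun P => by
      obtain ⟨I, hI⟩ := eq_pSum_of_isPrime P.2
      exact ⟨I, Subtype.ext hI⟩⟩
  map_rel_iff' := pSum_le_pSum_iff

theorem specIso_apply [CharZero K] (I : Finset (Fin n)) :
    specIso K n I = ⟨pSum K I, isPrime_pSum I⟩ := rfl

end
end IntDiff
end

noncomputable section

namespace IntDiff
open MvPolynomial

/-! ## Chains of finite sets -/

theorem height_finset {α : Type*} (I : Finset α) : Order.height I = I.card := by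
  classical
  apply le_antisymm
  · have := Order.height_le_height_apply_of_strictMono (Finset.card (α := α))
      Finset.card_strictMono I
    rwa [Order.height_nat] at this
  · induction I using Finset.induction_on with
    | empty => simp
    | insert a s ha ih =>
      rw [Finset.card_insert_of_notMem ha]
      push_cast
      exact (add_le_add_left ih 1).trans (Order.height_add_one_le (Finset.ssubset_insert ha))

/-- Each covering step adds exactly one element, so the endpoints determine the length; this is
catenarity. -/
theorem card_eq_of_covBy_series {α β : Type*} [Preorder β] (φ : β ≃o Finset α)
    (c : RelSeries {(p, q) : β × β | p ⋖ q}) :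
    (φ c.last).card = (φ c.head).card + c.length := by
  have key : ∀ (i : ℕ) (hi : i < c.length + 1), (φ (c ⟨i, hi⟩)).card = (φ c.head).card + i := by
    intro i
    induction i with
    | zero => intro _; rfl
    | succ i ih =>
      intro hi
      have h1 : c ⟨i, by omega⟩ ⋖ c ⟨i + 1, hi⟩ := c.step ⟨i, by omega⟩
      have h2 := Nat.covBy_iff_add_one_eq.1 ((apply_covBy_apply_iff φ).2 h1).card_finset
      rw [← h2, ih, add_assoc]
  exact key c.length (Nat.lt_succ_self _)

/-! ## Antichains in the cube -/

/-- The characteristic function of a finite set. -/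
def charFun {n : ℕ} (I : Finset (Fin n)) : Fin n → Fin 2 := fun i => if i ∈ I then 1 else 0

theorem charFun_le_charFun {n : ℕ} {I J : Finset (Fin n)} : charFun I ≤ charFun J ↔ I ⊆ J := by
  constructor
  · intro h i hi
    by_contra hJ
    have := h i
    simp [charFun, hi, hJ] at this
  · intro h i
    by_cases hi : i ∈ I
    · simp [charFun, hi, h hi]
    · simp [charFun, hi]

theorem charFun_injective {n : ℕ} : Function.Injective (charFun (n := n)) := fun _ _ h =>
  Finset.Subset.antisymm (charFun_le_charFun.1 h.le) (charFun_le_charFun.1 h.ge)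

theorem dedekindNumber_le (n : ℕ) : dedekindNumber n ≤ 2 ^ 2 ^ n := by
  calc dedekindNumber n ≤ Nat.card (Set (Fin n → Fin 2)) := Finite.card_subtype_le _
    _ = 2 ^ 2 ^ n := by simp [Nat.card_eq_fintype_card]

/-- The families of sets of the same size, which are antichains. -/
def layerFamilies (n : ℕ) : Finset (Finset (Finset (Fin n))) :=
  insert ∅ ((Finset.range (n + 1)).biUnion fun i =>
    (Finset.powersetCard i Finset.univ).powerset.erase ∅)

/-- The empty family belongs to every layer and is counted once, giving `1 + ∑_{i=0}^n (2 ^ n.choose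
i - 1)`; the term `i = 0` is `1`. -/
theorem card_layerFamilies (n : ℕ) :
    ((layerFamilies n).card : ℤ) = 2 - n + ∑ i ∈ Finset.Icc 1 n, (2 : ℤ) ^ n.choose i := by
  rw [layerFamilies, Finset.card_insert_of_notMem (by simp), Finset.card_biUnion]
  · have h : ∀ i, (((Finset.powersetCard i (Finset.univ : Finset (Fin n))).powerset.erase ∅).card
        : ℤ) = 2 ^ n.choose i - 1 := by
      intro i
      rw [Finset.card_erase_of_mem (Finset.empty_mem_powerset _), Finset.card_powerset,
        Finset.card_powersetCard, Finset.card_univ, Fintype.card_fin,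
        Nat.cast_sub Nat.one_le_two_pow]
      push_cast
      rfl
    push_cast
    rw [Finset.sum_congr rfl fun i _ => h i, Finset.sum_range_succ', Finset.sum_sub_distrib,
      Finset.range_eq_Ico, Finset.sum_Ico_add' (fun i => (2 : ℤ) ^ n.choose i) 0 n 1]
    simp only [Finset.sum_const, Nat.card_Ico, Nat.choose_zero_right]
    have : Finset.Ico (0 + 1) (n + 1) = Finset.Icc 1 n := by ext; simp
    rw [this]
    simp
    ring
  · intro i _ j _ hij
    rw [Function.onFun, Finset.disjoint_left]
    intro s hs hs'
    rw [Finset.mem_erase, Finset.mem_powerset] at hs hs'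
    obtain ⟨I, hI⟩ := Finset.nonempty_iff_ne_empty.2 hs.1
    exact hij ((Finset.mem_powersetCard.1 (hs.2 hI)).2.symm.trans
      (Finset.mem_powersetCard.1 (hs'.2 hI)).2)

theorem isAntichain_of_mem_layerFamilies {n : ℕ} {s : Finset (Finset (Fin n))}
    (hs : s ∈ layerFamilies n) : IsAntichain (· ≤ ·) (charFun '' (s : Set (Finset (Fin n)))) := by
  rintro _ ⟨I, hI, rfl⟩ _ ⟨J, hJ, rfl⟩ hne hle
  rw [charFun_le_charFun] at hle
  rcases Finset.mem_insert.1 hs with rfl | hs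
  · simp at hI
  · obtain ⟨i, _, hi⟩ := Finset.mem_biUnion.1 hs
    have h := Finset.mem_powerset.1 (Finset.mem_erase.1 hi).2
    have h1 := (Finset.mem_powersetCard.1 (h hI)).2
    have h2 := (Finset.mem_powersetCard.1 (h hJ)).2
    exact hne (congrArg _ (Finset.eq_of_subset_of_card_le hle (by omega)))

theorem le_dedekindNumber (n : ℕ) :
    2 - (n : ℤ) + ∑ i ∈ Finset.Icc 1 n, (2 : ℤ) ^ n.choose i ≤ dedekindNumber n := by
  rw [← card_layerFamilies]
  rw [Nat.cast_le, dedekindNumber]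
  let φ : layerFamilies n → Antichains n := fun s =>
    ⟨charFun '' (s.1 : Set (Finset (Fin n))), isAntichain_of_mem_layerFamilies s.2⟩
  have hφ : Function.Injective φ := fun s t h => by
    have h' := congrArg Subtype.val h
    exact Subtype.ext (Finset.coe_injective (charFun_injective.image_injective h'))
  simpa using Nat.card_le_card_of_injective φ hφ

section

variable {K : Type*} [Field K] {n : ℕ}

/-- Complements appear because `T` contains all zeros of `f` exactly when `f` is `1` on `Tᶜ`. -/
theorem projProd_mem_idealOfAntichain [CharZero K] {C : Antichains n} {T : Finset (Fin n)} :
    projProd K T ∈ idealOfAntichain K C ↔ ∃ f ∈ C.1, charFun Tᶜ ≤ f := by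
  simp only [idealOfAntichain, projProd_mem_iSup, projProd_mem_idealI, exists_prop]
  refine exists_congr fun f => and_congr_right fun _ => ⟨fun h i => ?_, fun h i hi => ?_⟩
  · by_cases hf : f i = 0
    · simp [charFun, h i hf]
    · have : f i = 1 := by omega
      rw [this]
      exact Fin.le_last (n := 1) _
  · by_contra hT
    have := h i
    simp [charFun, hT, hi] at this

theorem exists_charFun_compl (f : Fin n → Fin 2) : ∃ T : Finset (Fin n), charFun Tᶜ = f := by
  refine ⟨Finset.univ.filter fun i => f i = 0, funext fun i => ?_⟩
  by_cases hf : f i = 0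
  · simp [charFun, hf]
  · have : f i = 1 := by omega
    simp [charFun, this]

/-- The ideal determines the down-set generated by the antichain, and the antichain consists of its
maximal elements. Conversely, every ideal gives a down-set in a finite order, generated by its
maximal elements. -/
theorem idealOfAntichain_bijective [CharZero K] :
    Function.Bijective (idealOfAntichain K (n := n)) := by
  constructor
  · have key : ∀ C D : Antichains n, idealOfAntichain K C = idealOfAntichain K D → C.1 ⊆ D.1 := by
      intro C D h
      have h1 : ∀ g, (∃ f ∈ C.1, g ≤ f) ↔ ∃ f ∈ D.1, g ≤ f := by
        intro g
        obtain ⟨T, rfl⟩ := exists_charFun_compl g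
        rw [← projProd_mem_idealOfAntichain (K := K), h, projProd_mem_idealOfAntichain]
      intro f hf
      obtain ⟨f', hf', hle⟩ := (h1 f).1 ⟨f, hf, le_rfl⟩
      obtain ⟨f'', hf'', hle'⟩ := (h1 f').2 ⟨f', hf', le_rfl⟩
      have e := C.2.eq hf hf'' (hle.trans hle')
      have e' : f = f' := le_antisymm hle (e ▸ hle')
      rwa [e']
    exact fun C D h => Subtype.ext (Set.Subset.antisymm (key C D h) (key D C h.symm))
  · intro a
    have hmem : ∀ T S : Finset (Fin n), projProd K T ∈ a → charFun Sᶜ ≤ charFun Tᶜ →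
        projProd K S ∈ a := fun T S hT h =>
      projProd_mem_mono (Finset.compl_subset_compl.1 (charFun_le_charFun.1 h)) hT
    let P : (Fin n → Fin 2) → Prop := fun f => ∃ T, charFun Tᶜ = f ∧ projProd K T ∈ a
    refine ⟨⟨{f | Maximal P f}, fun f hf g hg hne hle => hne (hf.eq_of_le hg.prop hle)⟩,
      ext_projProd fun T => ?_⟩
    rw [projProd_mem_idealOfAntichain]
    constructor
    · rintro ⟨f, hf, hle⟩
      obtain ⟨S, rfl, hS⟩ := hf.prop
      exact hmem S T hS hle
    · intro hT
      obtain ⟨g, hg, hmax⟩ := Finite.exists_le_maximal (p := P) ⟨T, rfl, hT⟩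
      exact ⟨g, hmax, hg⟩

/-! ## Largest, smallest and height one ideals -/

/-- A nonzero ideal contains some `projProd K T`, hence the one for all variables, which generates
`F_n`. -/
theorem Fn_le_of_ne_bot [CharZero K] {a : TwoSidedIdeal (algebraI K n)} (ha : a ≠ ⊥) :
    Fn K n ≤ a := by
  have h : projProd K Finset.univ ∈ a := by
    by_contra h
    exact ha (le_bot_iff.1 (ideal_le_of_projProd_mem fun T hT =>
      absurd (projProd_mem_mono (Finset.subset_univ T) hT) h))
  refine ideal_le_of_projProd_mem fun T hT => ?_
  rw [projProd_mem_Fn] at hT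
  rwa [Finset.eq_univ_of_forall hT]

theorem Fn_ne_bot [CharZero K] : Fn K n ≠ ⊥ := by
  intro h
  apply projProd_notMem_bot (K := K) (Finset.univ : Finset (Fin n))
  rw [← h, projProd_mem_Fn]
  exact Finset.mem_univ

theorem isGreatest_aMax [CharZero K] :
    IsGreatest {a : TwoSidedIdeal (algebraI K n) | a ≠ ⊤} (aMax K n) := by
  constructor
  · change aMax K n ≠ ⊤
    rw [Ne, eq_top_iff_projProd_mem, projProd_mem_aMax]
    exact Finset.not_nonempty_empty
  · intro a ha
    refine ideal_le_of_projProd_mem fun T hT => ?_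
    rw [projProd_mem_aMax, Finset.nonempty_iff_ne_empty]
    rintro rfl
    exact ha (eq_top_iff_projProd_mem.2 hT)

theorem isCoatom_iff_eq_aMax [CharZero K] (m : TwoSidedIdeal (algebraI K n)) :
    IsCoatom m ↔ m = aMax K n := by
  obtain ⟨h1, h2⟩ := isGreatest_aMax (K := K) (n := n)
  constructor
  · intro hm
    by_contra hne
    exact h1 (hm.2 _ (lt_of_le_of_ne (h2 hm.1) hne))
  · rintro rfl
    refine ⟨h1, fun b hb => ?_⟩
    by_contra hne
    exact hb.not_ge (h2 hne)

theorem Fn_eq_iInf [CharZero K] : Fn K n = ⨅ i, p K i :=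
  ext_projProd fun T => by
    simp only [TwoSidedIdeal.mem_iInf, projProd_mem_Fn, projProd_mem_p]

theorem pSum_empty : pSum K (∅ : Finset (Fin n)) = ⊥ := by simp [pSum]

theorem pSum_singleton (i : Fin n) : pSum K {i} = p K i := by simp [pSum]

theorem height_pSum [CharZero K] (I : Finset (Fin n)) :
    RingIdeal.height ⟨pSum K I, isPrime_pSum I⟩ = I.card := by
  rw [RingIdeal.height, ← specIso_apply, Order.height_orderIso, height_finset]

theorem height_eq_one_iff [CharZero K] {P : TwoSidedIdeal (algebraI K n)} :
    (∃ hP : RingIdeal.IsPrime P, RingIdeal.height ⟨P, hP⟩ = 1) ↔ ∃ i, p K i = P := by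
  constructor
  · rintro ⟨hP, h⟩
    obtain ⟨I, rfl⟩ := eq_pSum_of_isPrime hP
    rw [height_pSum] at h
    obtain ⟨i, rfl⟩ := Finset.card_eq_one.1 (by exact_mod_cast h)
    exact ⟨i, (pSum_singleton i).symm⟩
  · rintro ⟨i, rfl⟩
    rw [← pSum_singleton]
    exact ⟨isPrime_pSum _, by rw [height_pSum]; simp⟩

theorem sSup_image_p (I : Finset (Fin n)) :
    sSup (p K '' (I : Set (Fin n))) = pSum K I := by
  rw [sSup_image, pSum]; rfl

theorem existsUnique_eq_sSup [CharZero K] {P : TwoSidedIdeal (algebraI K n)}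
    (hP : RingIdeal.IsPrime P) :
    ∃! S : Set (TwoSidedIdeal (algebraI K n)),
      (∀ Q ∈ S, ∃ hQ : RingIdeal.IsPrime Q, RingIdeal.height ⟨Q, hQ⟩ = 1) ∧ P = sSup S := by
  classical
  obtain ⟨I, rfl⟩ := eq_pSum_of_isPrime hP
  refine ⟨p K '' (I : Set (Fin n)), ⟨?_, (sSup_image_p I).symm⟩, ?_⟩
  · rintro _ ⟨i, _, rfl⟩
    exact height_eq_one_iff.2 ⟨i, rfl⟩
  · rintro S ⟨hS, hI⟩
    -- Height one primes are the `𝔭_i`, so `S` comes from a set of indices, which its sum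
    -- determines.
    have hJ : S = p K '' ((Finset.univ.filter fun i => p K i ∈ S : Finset (Fin n)) : Set (Fin n)) := by
      ext Q
      constructor
      · intro hQ
        obtain ⟨i, rfl⟩ := height_eq_one_iff.1 (hS Q hQ)
        exact ⟨i, by simpa using hQ, rfl⟩
      · rintro ⟨i, hi, rfl⟩
        simpa using hi
    rw [hJ, sSup_image_p] at hI
    rw [hJ, Finset.Subset.antisymm (pSum_le_pSum_iff.1 hI.le) (pSum_le_pSum_iff.1 hI.ge)]

theorem classicalKrullDim_eq [CharZero K] : RingIdeal.classicalKrullDim (algebraI K n) = n := by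
  rw [RingIdeal.classicalKrullDim, ← Order.krullDim_eq_of_orderIso (specIso K n),
    ← Order.height_top_eq_krullDim, height_finset]
  simp

theorem isCatenary [CharZero K] : RingIdeal.IsCatenary (algebraI K n) := by
  refine ⟨?_, fun c d hhead hlast => ?_⟩
  · rw [classicalKrullDim_eq]
    exact WithBot.coe_lt_coe.2 (ENat.natCast_lt_top n)
  · have h1 := card_eq_of_covBy_series (specIso K n).symm c
    have h2 := card_eq_of_covBy_series (specIso K n).symm d
    rw [hhead, hlast] at h1
    omega

/-- With a single variable, the smallest nonzero ideal and the largest proper ideal coincide. -/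
theorem ne_bot_and_ne_top_iff [CharZero K] (hn : n = 1) (a : TwoSidedIdeal (algebraI K n)) :
    (a ≠ ⊥ ∧ a ≠ ⊤) ↔ a = Fn K n := by
  have h : Fn K n = aMax K n := ext_projProd fun T => by
    subst hn
    rw [projProd_mem_Fn, projProd_mem_aMax]
    exact ⟨fun h => ⟨0, h 0⟩, fun ⟨i, hi⟩ j => Subsingleton.elim i j ▸ hi⟩
  constructor
  · rintro ⟨h1, h2⟩
    exact le_antisymm (h ▸ isGreatest_aMax.2 h2) (Fn_le_of_ne_bot h1)
  · rintro rfl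
    exact ⟨Fn_ne_bot, h ▸ isGreatest_aMax.1⟩

end
end IntDiff
end

theorem mainTheorem2 {K : Type*} [Field K] [CharZero K] (n : ℕ) :
    -- the subspaces `I_f` are two-sided ideals
    (∀ f : Fin n → Fin 2,
      (IntDiff.idealI K f : Set (IntDiff.algebraI K n)) = IntDiff.tensorSubspace K f) ∧
    -- the algebra is prime
    RingIdeal.IsPrimeRing (IntDiff.algebraI K n) ∧
    -- the height one primes
    {P : TwoSidedIdeal (IntDiff.algebraI K n) |
      ∃ hP : RingIdeal.IsPrime P, RingIdeal.height ⟨P, hP⟩ = 1} = Set.range (IntDiff.p K) ∧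
    -- ideals are idempotent, commute, form a distributive lattice
    (∀ a : TwoSidedIdeal (IntDiff.algebraI K n), RingIdeal.mul a a = a) ∧
    (∀ a b : TwoSidedIdeal (IntDiff.algebraI K n), RingIdeal.mul a b = RingIdeal.mul b a) ∧
    (∀ a b c : TwoSidedIdeal (IntDiff.algebraI K n), a ⊓ (b ⊔ c) = (a ⊓ b) ⊔ (a ⊓ c)) ∧
    -- the classical Krull dimension
    RingIdeal.classicalKrullDim (IntDiff.algebraI K n) = n ∧
    -- products are intersections
    (∀ a b : TwoSidedIdeal (IntDiff.algebraI K n), RingIdeal.mul a b = a ⊓ b) ∧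
    -- the largest proper ideal, the only maximal ideal, and the smallest nonzero ideal
    IsGreatest {a : TwoSidedIdeal (IntDiff.algebraI K n) | a ≠ ⊤} (IntDiff.aMax K n) ∧
    (∀ m : TwoSidedIdeal (IntDiff.algebraI K n), IsCoatom m ↔ m = IntDiff.aMax K n) ∧
    IntDiff.Fn K n = ⨅ i, IntDiff.p K i ∧
    IsLeast {a : TwoSidedIdeal (IntDiff.algebraI K n) | a ≠ ⊥} (IntDiff.Fn K n) ∧
    -- classification of ideals by antichains, and their number
    Function.Bijective (IntDiff.idealOfAntichain K (n := n)) ∧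
    Nat.card (TwoSidedIdeal (IntDiff.algebraI K n)) = IntDiff.dedekindNumber n ∧
    (2 - (n : ℤ) + ∑ i ∈ Finset.Icc 1 n, (2 : ℤ) ^ n.choose i ≤ IntDiff.dedekindNumber n) ∧
    IntDiff.dedekindNumber n ≤ 2 ^ 2 ^ n ∧
    (n = 1 → ∀ a : TwoSidedIdeal (IntDiff.algebraI K n),
      (a ≠ ⊥ ∧ a ≠ ⊤) ↔ a = IntDiff.Fn K n) ∧
    -- classification of prime ideals, their number, and their heights
    (∃ h : ∀ I : Finset (Fin n), RingIdeal.IsPrime (IntDiff.pSum K I),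
      Function.Bijective
        (fun I : Finset (Fin n) =>
          (⟨IntDiff.pSum K I, h I⟩ : RingIdeal.Spec (IntDiff.algebraI K n))) ∧
      ∀ I : Finset (Fin n), RingIdeal.height ⟨IntDiff.pSum K I, h I⟩ = I.card) ∧
    (∀ P : TwoSidedIdeal (IntDiff.algebraI K n), RingIdeal.IsPrime P → P ≠ ⊥ →
      ∃! S : Set (TwoSidedIdeal (IntDiff.algebraI K n)),
        (∀ Q ∈ S, ∃ hQ : RingIdeal.IsPrime Q, RingIdeal.height ⟨Q, hQ⟩ = 1) ∧ P = sSup S) ∧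
    Nat.card (RingIdeal.Spec (IntDiff.algebraI K n)) = 2 ^ n ∧
    (∀ I J : Finset (Fin n), IntDiff.pSum K I ≤ IntDiff.pSum K J ↔ I ⊆ J) ∧
    (∀ I J : Finset (Fin n), IntDiff.pSum K I < IntDiff.pSum K J ↔ I ⊂ J) ∧
    -- catenarity
    RingIdeal.IsCatenary (IntDiff.algebraI K n) := by
  refine ⟨IntDiff.coe_idealI, ?_, ?_, ?_, ?_, IntDiff.inf_sup_distrib,
    IntDiff.classicalKrullDim_eq, IntDiff.mul_eq_inf, IntDiff.isGreatest_aMax,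
    IntDiff.isCoatom_iff_eq_aMax, IntDiff.Fn_eq_iInf,
    ⟨IntDiff.Fn_ne_bot, fun a ha => IntDiff.Fn_le_of_ne_bot ha⟩,
    IntDiff.idealOfAntichain_bijective, ?_, IntDiff.le_dedekindNumber n,
    IntDiff.dedekindNumber_le n, IntDiff.ne_bot_and_ne_top_iff,
    ⟨IntDiff.isPrime_pSum, (IntDiff.specIso K n).bijective, IntDiff.height_pSum⟩,
    fun P hP _ => IntDiff.existsUnique_eq_sSup hP, ?_, fun I J => IntDiff.pSum_le_pSum_iff, ?_,
    IntDiff.isCatenary⟩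
  · rw [RingIdeal.IsPrimeRing, ← IntDiff.pSum_empty]
    exact IntDiff.isPrime_pSum ∅
  · ext P
    exact IntDiff.height_eq_one_iff
  · intro a
    rw [IntDiff.mul_eq_inf, inf_idem]
  · intro a b
    rw [IntDiff.mul_eq_inf, IntDiff.mul_eq_inf, inf_comm]
  · exact (Nat.card_congr (Equiv.ofBijective _ IntDiff.idealOfAntichain_bijective)).symm
  · rw [← Nat.card_congr (IntDiff.specIso K n).toEquiv]
    simp
  · intro I J
    rw [lt_iff_le_not_ge, IntDiff.pSum_le_pSum_iff, IntDiff.pSum_le_pSum_iff]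
    rfl
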